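/- Notation. For a set $X$, $[X]^{<\omega}$ is the set of its finite subsets; for an ordinal $\alpha$, $\alpha+1=\{\gamma:\gamma\le\alpha\}$. $H(\vartheta)$ is the collection of sets whose transitive closure has size less than $\vartheta$. $\mathcal W$ is the family of all $Q^*=\{H\in[\mathbb R]^{<\omega}:H\subseteq Q\}$, where $Q\subseteq\mathbb R$ is a union of finitely many pairwise disjoint open intervals with rational endpoints. A family $\mathcal N$ of subsets of a space is a local $\pi$-network at $x$ if every open $V\ni x$ contains some $N\in\mathcal N$; a family $\mathcal U$ of sets is an $\omega$-cover of $Y$ if each finite $K\subseteq Y$ is contained in some $U\in\mathcal U$. A $D$-space is a ($T_1$) space $X$ such that for every assignment of open neighbourhoods $x\mapsto N_x$ there is a closed discrete $D\subseteq X$ with $\bigcup_{x\in D}N_x=X$. A space has countable $\Psi$-weight if there is a countable family $\mathcal V$ of open sets with $\bigcap\{V\in\mathcal V:x\in V\}=\{x\}$ for every point $x$. A space is hereditarily Lindelöf if in each of its subspaces every open cover has a countable subcover. Theorem. Assume $\diamondsuit$, and fix a cardinal $\kappa\ge 2^{\aleph_1}$. Then there is an enumeration $\{C_\alpha\}_{\alpha<\omega_1}$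 of the countable subsets of $\omega_1$ with $C_\alpha\subseteq\alpha$ for all $\alpha$, and there is a sequence $\{B_\gamma\}_{\gamma<\omega_1}$ of subsets of $[\omega_1]^{<\omega}$ such that for every uncountable $B\subseteq[\omega_1]^{<\omega}$ the set $\{\beta<\omega_1:B\cap[\beta]^{<\omega}=B_\beta\}$ is stationary. Moreover, for all $\{C_\alpha\}$ and $\{B_\gamma\}$ of this kind the following two assertions hold. (A) There are sets $U^\alpha_\gamma$ ($\gamma\le\alpha<\omega_1$) and maps $\varphi_\alpha:\alpha+1\to[\mathbb R]^{<\omega}$ ($\alpha<\omega_1$) such that, with $\tau_\alpha$ the topology on $\alpha+1$ with subbase $\{U^\alpha_\gamma:\gamma\le\alpha\}\cup\{\varphi_\alpha^{-1}(W):W\in\mathcal W\}$ and $U^\alpha_F=\{x\le\alpha: x\in U^\alpha_\gamma\text{ for all }\gamma\in F\}$: 1. $U^\alpha_\gamma\subseteq\alpha+1$ and $U^\alpha_\alpha=\alpha+1$; the sets $\varphi_\alpha(\gamma)$, $\gamma\le\alpha$, are nonempty, and $\varphi_\alpha(\gamma)\cap\varphi_\alpha(\delta)=\emptyset$ for $\gamma\ne\delta$.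 2. $U^\alpha_\gamma=U^{\alpha_0}_\gamma\cap(\alpha+1)$ and $\varphi_\alpha=\varphi_{\alpha_0}\upharpoonright(\alpha+1)$ for $\gamma\le\alpha\le\alpha_0$. 3. If $C_\alpha$ is closed discrete in $\tau_\alpha$, then $\bigcup\{U^\alpha_\gamma:\gamma\in C_\alpha\}\ne\alpha+1$. 4. Let $T_\alpha$ be the set of those $\beta\le\alpha$ for which $B_\beta$ is a pairwise disjoint family of finite subsets of $\beta$ and, for some cardinal $\vartheta>\kappa$, there is a countable elementary submodel $M\prec H(\vartheta)$ such that: (i) $M\cap\omega_1=\beta$; (ii) $\mathcal W,\{B_\gamma\}_{\gamma<\omega_1}\in M$; (iii) some function $g\in M$ satisfies $g\upharpoonright\beta=\varphi_\beta\upharpoonright\beta$; (iv) some uncountable $B\in M$ satisfies $M\cap B=B_\beta$; (v) some sequence $\{V_\gamma\}_{\gamma<\omega_1}\in M$ satisfies $V_\gamma\cap\beta=U^\beta_\gamma\cap\beta$ for all $\gamma<\beta$. Then (a) if $\beta\in T_\alpha$, then $B_\beta$ is a local $\pi$-network at $\beta$ in $\tau_\alpha$; and (b) if $\beta\in T_\alpha\cap\alpha$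 and $\beta\in V\in\tau_\alpha$, then $\{U^\alpha_F:F\in B_\beta,\ F\subseteq V\}$ is an $\omega$-cover of $(\beta,\alpha]$. (B) For all $\{U^\alpha_\gamma\}$ and $\{\varphi_\alpha\}$ with properties 1–4, put $U_\gamma=\bigcup\{U^\alpha_\gamma:\gamma\le\alpha<\omega_1\}$ and $\varphi=\bigcup\{\varphi_\alpha:\alpha<\omega_1\}$, and let $\tau$ be the topology on $\omega_1$ with subbase $\{U_\gamma:\gamma<\omega_1\}\cup\{\varphi^{-1}(W):W\in\mathcal W\}$. Then $(\omega_1,\tau)$ is hereditarily Lindelöf and Hausdorff, has countable $\Psi$-weight, and is not a $D$-space. In particular, $\diamondsuit$ implies that there is a Hausdorff, hereditarily Lindelöf space of size $\omega_1$ that is not a $D$-space. -/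

import Mathlib

open Set
open scoped Cardinal Ordinal Topology

/-! ### The set `ω₁`, the principle `◇`, and the enumerations derived from it -/

/-- The set `ω₁` of countable ordinals. For `α : Omega1`, the ordinal `α` is the set `Iio α`, and
`α + 1` is the set `Iic α`. -/
abbrev Omega1 : Type := (ω₁ : Ordinal.{0}).ToType

/-- The combinatorial principle `◇`. -/
def Diamond : Prop :=
  ∃ A : Omega1 → Set Omega1, (∀ α, A α ⊆ Iio α) ∧
    ∀ X : Set Omega1, IsStationary {α | X ∩ Iio α = A α}

/-- `C` enumerates the countable subsets of `ω₁`, with `C α ⊆ α` for all `α`. -/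
def EnumeratesCountableSets (C : Omega1 → Set Omega1) : Prop :=
  range C = {s | s.Countable} ∧ ∀ α, C α ⊆ Iio α

/-- The set `[β]^{<ω}` of finite subsets of `β`. -/
def finsetsBelow (β : Omega1) : Set (Finset Omega1) := {F | ∀ γ ∈ F, γ < β}

/-- `B` is a `◇`-sequence on `[ω₁]^{<ω}`. -/
def IsFinsetDiamondSeq (B : Omega1 → Set (Finset Omega1)) : Prop :=
  ∀ 𝓑 : Set (Finset Omega1), ¬ 𝓑.Countable → IsStationary {β | 𝓑 ∩ finsetsBelow β = B β}

/-! ### Topological notions -/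

/-- `s` is a closed discrete subset of the space `(X, t)`. -/
def IsClosedDiscreteIn {X : Type*} (t : TopologicalSpace X) (s : Set X) : Prop :=
  IsClosed[t] s ∧ @IsDiscrete X t s

/-- The defining property of `D`-spaces: for every open neighbourhood assignment `N` there is a
closed discrete set `D` such that `{N x : x ∈ D}` covers the space. -/
def IsDSpace {X : Type*} (t : TopologicalSpace X) : Prop :=
  ∀ N : X → Set X, (∀ x, IsOpen[t] (N x) ∧ x ∈ N x) →
    ∃ D : Set X, IsClosedDiscreteIn t D ∧ ⋃ x ∈ D, N x = univ

/-- `(X, t)` has countable `Ψ`-weight: some countable family of open sets satisfies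
`⋂ {V ∈ 𝓥 : x ∈ V} = {x}` for every point `x`. -/
def HasCountablePsiWeight {X : Type*} (t : TopologicalSpace X) : Prop :=
  ∃ 𝓥 : Set (Set X), 𝓥.Countable ∧ (∀ V ∈ 𝓥, IsOpen[t] V) ∧
    ∀ x, ⋂₀ {V ∈ 𝓥 | x ∈ V} = {x}

/-- `𝓟` is a local `π`-network at `x`. -/
def IsLocalPiNetwork {X : Type*} (t : TopologicalSpace X) (𝓟 : Set (Set X)) (x : X) : Prop :=
  ∀ V : Set X, IsOpen[t] V → x ∈ V → ∃ N ∈ 𝓟, N ⊆ V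

/-- `𝓤` is an `ω`-cover of `Y`: every finite subset of `Y` is contained in a member of `𝓤`. -/
def IsOmegaCover {X : Type*} (𝓤 : Set (Set X)) (Y : Set X) : Prop :=
  ∀ K : Finset X, (K : Set X) ⊆ Y → ∃ V ∈ 𝓤, (K : Set X) ⊆ V

/-- For `Q ⊆ ℝ`, the set `Q* = {H ∈ [ℝ]^{<ω} : H ⊆ Q}`. -/
def starSet (Q : Set ℝ) : Set (Finset ℝ) := {H | (H : Set ℝ) ⊆ Q}

/-- The family `𝒲` of all `Q*`, where `Q` is a union of finitely many pairwise disjoint open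
intervals with rational endpoints. -/
def ratStars : Set (Set (Finset ℝ)) :=
  {W | ∃ I : Finset (ℚ × ℚ), (∀ p ∈ I, p.1 < p.2) ∧
    (I : Set (ℚ × ℚ)).PairwiseDisjoint (fun p => Ioo (p.1 : ℝ) (p.2 : ℝ)) ∧
    W = starSet (⋃ p ∈ I, Ioo (p.1 : ℝ) (p.2 : ℝ))}

/-! ### Elementary submodels of `H(θ)` -/

/-- The symbols of the language of set theory: one binary relation symbol. -/
inductive SetTheoryRel : ℕ → Type
  | mem : SetTheoryRel 2

/-- The first-order language of set theory. -/
def setTheoryLanguage : FirstOrder.Language.{0, 0} := ⟨fun _ => Empty, SetTheoryRel⟩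

/-- `H(θ)`: the sets whose transitive closure has fewer than `θ` elements. The transitive closure
of `x` consists of the sets related to `x` by the transitive closure of the relation `∈`. -/
def HSet (θ : Cardinal.{0}) : Type 1 :=
  {x : ZFSet.{0} // #{y : ZFSet.{0} // Relation.TransGen (fun a b : ZFSet.{0} => a ∈ b) y x}
    < Cardinal.lift.{1} θ}

/-- `H(θ)` as a structure for the language of set theory, with the true membership relation. -/
noncomputable instance HSet.structure (θ : Cardinal.{0}) :
    setTheoryLanguage.Structure (HSet θ) where
  funMap := fun f => Empty.elim f
  RelMap := fun r => match r with
    | SetTheoryRel.mem => fun x => (x 0).1 ∈ (x 1).1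

/-- `M ≺ H(θ)`, for a set `M` of sets. -/
def IsElementarySubmodel (θ : Cardinal.{0}) (M : Set ZFSet.{0}) : Prop :=
  ∃ S : setTheoryLanguage.ElementarySubstructure (HSet θ),
    M = Subtype.val '' (S : Set (HSet θ))

/-! ### Mathematical objects as sets -/

/-- The set `{code x : x ∈ s}`. -/
noncomputable def codeSet {X : Type*} (code : X → ZFSet.{0}) (s : Set X) [Small.{0} s] :
    ZFSet.{0} :=
  ZFSet.range (fun x : s => code x)

/-- The countable ordinal `γ` as a von Neumann ordinal. -/
noncomputable def codeOrd (γ : Omega1) : ZFSet.{0} := (Ordinal.ToType.toOrd γ).1.toZFSet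

/-- A finite set of countable ordinals. -/
noncomputable def codeFinset (F : Finset Omega1) : ZFSet.{0} :=
  codeSet codeOrd (F : Set Omega1)

/-- A family of finite sets of countable ordinals. -/
noncomputable def codeFamily (𝓑 : Set (Finset Omega1)) : ZFSet.{0} :=
  codeSet codeFinset 𝓑

/-- A real number as a Dedekind cut: the set of the codes of the rational numbers below it, where
the rational numbers are coded by natural numbers. -/
noncomputable def codeReal (r : ℝ) : ZFSet.{0} :=
  codeSet (fun q : ℚ => ((Encodable.encode q : ℕ) : Ordinal.{0}).toZFSet) {q : ℚ | (q : ℝ) < r}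

/-- A finite set of real numbers. -/
noncomputable def codeRealFinset (H : Finset ℝ) : ZFSet.{0} :=
  codeSet codeReal (H : Set ℝ)

/-- The family `𝒲` as a set. -/
noncomputable def codeRatStars : ZFSet.{0} :=
  codeSet (fun W : Set (Finset ℝ) => codeSet codeRealFinset W) ratStars

/-- The function with domain `s ⊆ ω₁` and values `f γ`, as a set of ordered pairs. -/
noncomputable def codeFun (s : Set Omega1) (f : Omega1 → ZFSet.{0}) : ZFSet.{0} :=
  codeSet (fun γ => ZFSet.pair (codeOrd γ) (f γ)) s

/-- The set `g` is a function, with any domain and range. -/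
def IsFunctionSet (g : ZFSet.{0}) : Prop :=
  (∀ p ∈ g, ∃ x y, p = ZFSet.pair x y) ∧
    ∀ x y z, ZFSet.pair x y ∈ g → ZFSet.pair x z ∈ g → y = z

/-- The restriction of the function `g` to the set `d`. -/
noncomputable def restrictFun (g d : ZFSet.{0}) : ZFSet.{0} :=
  ZFSet.sep (fun p => ∃ x ∈ d, ∃ y, p = ZFSet.pair x y) g

/-! ### The construction

A system consists of `U : ω₁ → ω₁ → Set ω₁`, where `U α γ` stands for `U^α_γ` and matters only for
`γ ≤ α`, and `φ : ω₁ → ω₁ → [ℝ]^{<ω}`, where `φ α` stands for the map `φ_α` on `α + 1` and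
`φ α γ` matters only for `γ ≤ α`. -/

/-- The topology `τ_α` on `α + 1`, generated by the sets `U^α_γ` for `γ ≤ α` and `φ_α⁻¹(W)` for
`W ∈ 𝒲`. -/
@[reducible] def levelTopology (U : Omega1 → Omega1 → Set Omega1) (φ : Omega1 → Omega1 → Finset ℝ)
    (α : Omega1) : TopologicalSpace (Iic α) :=
  TopologicalSpace.generateFrom
    ({s | ∃ γ ≤ α, s = {x : Iic α | (x : Omega1) ∈ U α γ}} ∪
      {s | ∃ W ∈ ratStars, s = {x : Iic α | φ α x ∈ W}})

/-- `U^α_F = ⋂ {U^α_γ : γ ∈ F}`, a subset of `α + 1`. -/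
def levelInter (U : Omega1 → Omega1 → Set Omega1) (α : Omega1) (F : Finset Omega1) :
    Set Omega1 :=
  {x | x ≤ α ∧ ∀ γ ∈ F, x ∈ U α γ}

/-- The countable set `M` is an elementary submodel of `H(θ)` with the properties (i)-(v)
required at `β`. -/
structure IsGuessingModel (B : Omega1 → Set (Finset Omega1))
    (U : Omega1 → Omega1 → Set Omega1) (φ : Omega1 → Omega1 → Finset ℝ) (β : Omega1)
    (θ : Cardinal.{0}) (M : Set ZFSet.{0}) : Prop where
  countable : M.Countable
  elementary : IsElementarySubmodel θ M
  /-- `M ∩ ω₁ = β` -/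
  inter_omega1 : M ∩ range codeOrd = codeOrd '' Iio β
  ratStars_mem : codeRatStars ∈ M
  diamond_mem : codeFun univ (fun γ => codeFamily (B γ)) ∈ M
  /-- some function in `M` has the same restriction to `β` as `φ_β` -/
  exists_map : ∃ g ∈ M, IsFunctionSet g ∧
    restrictFun g (codeOrd β) = codeFun (Iio β) (fun γ => codeRealFinset (φ β γ))
  /-- some uncountable `𝓑 ∈ M` satisfies `M ∩ 𝓑 = B_β` -/
  exists_family : ∃ 𝓑 ∈ M, ¬ {x : ZFSet.{0} | x ∈ 𝓑}.Countable ∧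
    M ∩ {x : ZFSet.{0} | x ∈ 𝓑} = codeFinset '' B β
  /-- some sequence `{V_γ}_{γ < ω₁}` in `M` satisfies `V_γ ∩ β = U^β_γ ∩ β` for `γ < β` -/
  exists_sequence : ∃ V : Omega1 → ZFSet.{0}, codeFun univ V ∈ M ∧
    ∀ γ < β, V γ ∩ codeOrd β = codeSet codeOrd (U β γ ∩ Iio β)

/-- The condition that puts an ordinal `β ≤ α` into `T_α`. A cardinal `θ` counts as sufficiently
large when `θ > κ`. -/
def IsGuessed (κ : Cardinal.{0}) (B : Omega1 → Set (Finset Omega1))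
    (U : Omega1 → Omega1 → Set Omega1) (φ : Omega1 → Omega1 → Finset ℝ) (β : Omega1) : Prop :=
  B β ⊆ finsetsBelow β ∧ (B β).PairwiseDisjoint id ∧
    ∃ θ : Cardinal.{0}, κ < θ ∧ ∃ M : Set ZFSet.{0}, IsGuessingModel B U φ β θ M

/-- The set `T_α`. -/
def guessedSet (κ : Cardinal.{0}) (B : Omega1 → Set (Finset Omega1))
    (U : Omega1 → Omega1 → Set Omega1) (φ : Omega1 → Omega1 → Finset ℝ) (α : Omega1) :
    Set Omega1 :=
  {β | β ≤ α ∧ IsGuessed κ B U φ β}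

/-- The system `(U, φ)` has the properties (1)-(4) of the construction. -/
structure IsConstruction (κ : Cardinal.{0}) (C : Omega1 → Set Omega1)
    (B : Omega1 → Set (Finset Omega1)) (U : Omega1 → Omega1 → Set Omega1)
    (φ : Omega1 → Omega1 → Finset ℝ) : Prop where
  /-- (1) -/
  subset : ∀ α, ∀ γ ≤ α, U α γ ⊆ Iic α
  self : ∀ α, U α α = Iic α
  nonempty : ∀ α, ∀ γ ≤ α, (φ α γ).Nonempty
  disjoint : ∀ α, ∀ γ ≤ α, ∀ δ ≤ α, γ ≠ δ → Disjoint (φ α γ) (φ α δ)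
  /-- (2) -/
  coherent_set : ∀ α₀, ∀ α ≤ α₀, ∀ γ ≤ α, U α γ = U α₀ γ ∩ Iic α
  coherent_map : ∀ α₀, ∀ α ≤ α₀, ∀ γ ≤ α, φ α γ = φ α₀ γ
  /-- (3) -/
  not_cover : ∀ α, IsClosedDiscreteIn (levelTopology U φ α) {x : Iic α | (x : Omega1) ∈ C α} →
    ⋃ γ ∈ C α, U α γ ≠ Iic α
  /-- (4a) -/
  piNetwork : ∀ α, ∀ β (hβ : β ≤ α), β ∈ guessedSet κ B U φ α →
    IsLocalPiNetwork (levelTopology U φ α)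
      {N | ∃ F ∈ B β, N = {x : Iic α | (x : Omega1) ∈ F}} ⟨β, hβ⟩
  /-- (4b) -/
  omegaCover : ∀ α, ∀ β (hβ : β < α), β ∈ guessedSet κ B U φ α →
    ∀ V : Set (Iic α), IsOpen[levelTopology U φ α] V → (⟨β, hβ.le⟩ : Iic α) ∈ V →
      IsOmegaCover
        {N | ∃ F ∈ B β, (F : Set Omega1) ⊆ Subtype.val '' V ∧ N = levelInter U α F}
        (Ioc β α)

/-- The set `U_γ = ⋃ {U^α_γ : γ ≤ α < ω₁}`. -/
def limitSet (U : Omega1 → Omega1 → Set Omega1) (γ : Omega1) : Set Omega1 :=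
  {x | ∃ α, γ ≤ α ∧ x ∈ U α γ}

/-- The map `φ = ⋃ {φ_α : α < ω₁}`. The value of `φ` at `γ` is that of `φ_γ`, and under coherence
this is the value of every `φ_α` with `γ ≤ α`. -/
def limitMap (φ : Omega1 → Omega1 → Finset ℝ) (γ : Omega1) : Finset ℝ := φ γ γ

/-- The topology `τ` on `ω₁` with subbase `{U_γ : γ < ω₁} ∪ {φ⁻¹(W) : W ∈ 𝒲}`. -/
@[reducible] def limitTopology (U : Omega1 → Omega1 → Set Omega1) (φ : Omega1 → Omega1 → Finset ℝ) :
    TopologicalSpace Omega1 :=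
  TopologicalSpace.generateFrom
    ({s | ∃ γ, s = limitSet U γ} ∪ {s | ∃ W ∈ ratStars, s = limitMap φ ⁻¹' W})

/-!
The space is built by recursion on `ω₁`: at stage `α` one decides to which `U_γ`, `γ < α`, the new
point `α` belongs, and chooses the finite set `φ(α)` of reals.

The finite sets `φ(x)` are disjoint and nonempty, so that countably many open sets, the preimages of
the members of `𝒲`, separate the points; this gives the Hausdorff property and countable `Ψ`-weight.
The assignment `γ ↦ U_γ` refutes the `D`-property: once closed discrete sets are known to be
countable, each of them is some `C α`, and by property (3) the sets `U_γ`, `γ ∈ C α`, do not even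
cover `α + 1`. For the hereditary Lindelöf property, the point is that a union of intersections
`U_F` of finitely many of the sets `U_γ` is the union of countably many of them
(`exists_countable_subfamily`). The essential case is that of an uncountable disjoint family `𝓑` of
finite sets `F`. By `◇`, and since there is a suitable elementary submodel at club many ordinals
(`exists_club_submodel`), some `B β ⊆ 𝓑` is guessed (`IsConstruction.exists_isGuessed`), and then
the countably many `U_F`, `F ∈ B β`, cover all points beyond `β` by property (4b).

The existence of the construction rests on a conflict being resolvable. Property (4b) asks that `α`
enter many intersections `U_F` with `F ∈ B β`, for the guessed `β < α`; property (4a) asks that,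
nevertheless, all basic neighbourhoods of a guessed `α` contain members of `B α`; and property (3)
asks that `α` stay out of `U_γ` for `γ ∈ C α`. The last request is harmless, because `F` can be
chosen inside neighbourhoods of `β` which meet `C α` at most in `β`, by (4a) and (4b) at earlier
stages. For the other two, let `M` be the elementary submodel at `α` and let `𝓑 ∈ M` be the
uncountable family with trace `B α`. If no `F ∈ B β` meeting the requirements of a task satisfied
`L ⊆ U_F`, where `L ∈ 𝓑` lies above `β`, then by elementarity this would hold for some `L ∈ B α`,
which contradicts (4b) at earlier stages. Hence for every such `L ∈ 𝓑` there is a suitable `F`, and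
since `B β` is countable, one `F` works for uncountably many `L`. Repeating this countably often
while shrinking the uncountable family and controlling the reals in `⋃ φ[L]` yields all the sets
`F` to be used and, as a limit, the set `φ(α)` (`Reflection.exists_selection`); by elementarity
again, members of `B α` lie in the resulting basic neighbourhoods of `α`. The facts about `M` used
here are isolated in the structure `Reflection`, which is derived from a guessing model in
`IsGuessingModel.exists_reflection`.

For elementarity, a predicate on `H(θ)` is called definable if some formula defines it (`FODef`);
`FODef.reflect` states that an elementary submodel contains witnesses for definable properties.
-/

/-! ### Clubs in `ω₁` and the consequences of `◇` -/

lemma mk_omega1 : #Omega1 = ℵ₁ := by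
  simp [Omega1]

lemma countable_Iio_omega1 (α : Omega1) : (Iio α).Countable := by
  have h : #(Iio α) < #Omega1 := Cardinal.mk_Iio_lt α (by simp [Omega1])
  rw [← Cardinal.le_aleph0_iff_set_countable]
  exact Cardinal.lt_aleph_one_iff.1 (h.trans_eq mk_omega1)

lemma countable_Iic_omega1 (α : Omega1) : (Iic α).Countable := by
  rw [← Iio_insert]
  exact (countable_Iio_omega1 α).insert α

instance : Uncountable Omega1 := by
  rw [← Cardinal.aleph0_lt_mk_iff, mk_omega1]
  exact Cardinal.aleph0_lt_aleph_one

lemma exists_gt_of_countable {s : Set Omega1} (hs : s.Countable) : ∃ β, ∀ x ∈ s, x < β := by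
  by_contra! h
  refine not_countable_univ ((hs.biUnion fun x _ => countable_Iic_omega1 x).mono ?_ :
    (univ : Set Omega1).Countable)
  intro y _
  obtain ⟨x, hx, hyx⟩ := h y
  exact mem_biUnion hx hyx

/-- The ordinals closed under a function `[ω₁]^{<ω} → ω₁` form a club. Unboundedness: iterate a
function `g` that dominates `f` on the finite subsets of initial segments; the least ordinal above
all iterates is closed. -/
lemma isClub_closed_finset (f : Finset Omega1 → Omega1) :
    IsClub {β | ∀ s : Finset Omega1, (∀ x ∈ s, x < β) → f s < β} := by
  refine ⟨fun t ht ht₀ _ β hβ s hs => ?_, fun a => ?_⟩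
  · obtain ⟨τ, hτ, hsτ⟩ : ∃ τ ∈ t, ∀ x ∈ s, x < τ := by
      induction s using Finset.induction_on with
      | empty => exact ht₀.imp fun τ hτ => ⟨hτ, by simp⟩
      | insert y s _ ih =>
        simp only [Finset.mem_insert, forall_eq_or_imp] at hs ⊢
        obtain ⟨τ, hτ, h⟩ := ih hs.2
        obtain ⟨τ', hτ', h'⟩ := (lt_isLUB_iff hβ).1 hs.1
        rcases le_total τ τ' with hl | hl
        · exact ⟨τ', hτ', h', fun x hx => (h x hx).trans_le hl⟩
        · exact ⟨τ, hτ, h'.trans_le hl, h⟩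
    exact (ht hτ s hsτ).trans_le (hβ.1 hτ)
  · have key : ∀ x : Omega1, ∃ y, x < y ∧ ∀ s : Finset Omega1, (∀ z ∈ s, z ≤ x) → f s < y := by
      intro x
      have hc : {s : Finset Omega1 | (s : Set Omega1) ⊆ Iic x}.Countable := by
        have := (Set.countable_ofPred_finite_subset (countable_Iic_omega1 x))
        refine (this.preimage (f := fun s : Finset Omega1 => (s : Set Omega1))
          Finset.coe_injective).mono ?_
        intro s hs
        exact ⟨s.finite_toSet, hs⟩
      obtain ⟨y, hy⟩ := exists_gt_of_countable ((hc.image f).insert x)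
      exact ⟨y, hy x (mem_insert _ _), fun s hs => hy _ (mem_insert_of_mem _ ⟨s, hs, rfl⟩)⟩
    choose g hg hgf using key
    obtain ⟨β₀, hβ₀⟩ := exists_gt_of_countable (countable_range fun n : ℕ => g^[n] a)
    let S : Set Omega1 := {y | ∀ n : ℕ, g^[n] a < y}
    have hS : S.Nonempty := ⟨β₀, fun n => hβ₀ _ ⟨n, rfl⟩⟩
    let β := wellFounded_lt.min S hS
    have hβ : β ∈ S := wellFounded_lt.min_mem S hS
    refine ⟨β, fun s hs => ?_, (hβ 0).le⟩
    have hx : ∀ x < β, ∃ n : ℕ, x ≤ g^[n] a := by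
      intro x hx
      by_contra! h
      exact wellFounded_lt.not_lt_min S h hx
    have hmono : Monotone fun n : ℕ => g^[n] a :=
      monotone_nat_of_le_succ fun n => by
        rw [Function.iterate_succ_apply']; exact (hg _).le
    obtain ⟨n, hn⟩ : ∃ n : ℕ, ∀ x ∈ s, x ≤ g^[n] a := by
      choose! N hN using hx
      exact ⟨s.sup N, fun x hxs => (hN x (hs x hxs)).trans (hmono (Finset.le_sup hxs))⟩
    have := hgf _ s hn
    rw [← Function.iterate_succ_apply' g n a] at this
    exact this.trans (hβ _)

lemma cof_omega1_ne : Order.cof Omega1 ≠ ℵ₀ := by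
  rw [Ordinal.cof_toType, Cardinal.cof_omega_one]
  exact Cardinal.aleph0_lt_aleph_one.ne'

/-- A `◇`-sequence is itself an enumeration of the countable subsets of `ω₁`: a countable `X` is
guessed at stationarily many places, hence at one beyond all of its elements. -/
lemma Diamond.exists_enumeration (hD : Diamond) :
    ∃ C : Omega1 → Set Omega1, EnumeratesCountableSets C := by
  obtain ⟨A, hA, hst⟩ := hD
  refine ⟨A, Subset.antisymm ?_ ?_, hA⟩
  · rintro _ ⟨α, rfl⟩
    exact (countable_Iio_omega1 α).mono (hA α)
  · intro X hX
    obtain ⟨b, hb⟩ := exists_gt_of_countable hX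
    obtain ⟨α, hα, hα'⟩ := hst X (isClub_closed_finset fun _ => b)
    have hbα : b < α := hα' ∅ (by simp)
    refine ⟨α, ?_⟩
    rw [← hα]
    exact inter_eq_left.2 fun x hx => (hb x hx).trans hbα

/-- Transport of a `◇`-sequence along a bijection `ω₁ ≃ [ω₁]^{<ω}`, which restricts to a bijection
`β ≃ [β]^{<ω}` for club many `β`. -/
lemma Diamond.exists_finsetDiamondSeq (hD : Diamond) :
    ∃ B : Omega1 → Set (Finset Omega1), IsFinsetDiamondSeq B := by
  obtain ⟨A, hA, hst⟩ := hD
  obtain ⟨e⟩ : Nonempty (Omega1 ≃ Finset Omega1) :=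
    Cardinal.eq.1 (Cardinal.mk_finset_of_infinite Omega1).symm
  have hb : ∀ s : Finset Omega1, ∃ b, ∀ x ∈ s, ∀ y ∈ e x, y < b := fun s => by
    obtain ⟨b, hb⟩ := exists_gt_of_countable
      (s.countable_toSet.biUnion fun x _ => (e x).countable_toSet)
    exact ⟨b, fun x hx y hy => hb y (mem_biUnion hx hy)⟩
  choose b hb using hb
  refine ⟨fun β => e '' A β, fun 𝓑 _ t ht => ?_⟩
  obtain ⟨β, h1, ⟨h2, h3⟩, h4⟩ := hst (e ⁻¹' 𝓑)
    (((isClub_closed_finset e.symm).inter cof_omega1_ne (isClub_closed_finset b)).inter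
      cof_omega1_ne ht)
  refine ⟨β, ?_, h4⟩
  change _ = e '' A β
  rw [← h1]
  ext F
  constructor
  · rintro ⟨hF, hFβ⟩
    exact ⟨e.symm F, ⟨by simpa using hF, h2 F hFβ⟩, by simp⟩
  · rintro ⟨x, ⟨hx, hxβ⟩, rfl⟩
    exact ⟨hx, fun y hy => (hb {x} x (by simp) y hy).trans (h3 {x} (by simpa using hxβ))⟩

/-! ### First-order definable predicates and reflection in elementary submodels -/

section Definability

open FirstOrder FirstOrder.Language

/-! Definability is phrased for predicates of assignments `ℕ → HSet θ`, so that it can be verified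
by rules that follow the logical structure of a Lean proposition, without writing formulas. -/

/-- Prepend a value to an assignment of the variables. -/
def consEnv {H : Type*} (x : H) (v : ℕ → H) : ℕ → H
  | 0 => x
  | n + 1 => v n

/-- The formula `∃ x₀, χ(x₀, x₁, …)`, with the remaining variables shifted down by one. -/
def existsFormula {L : FirstOrder.Language.{0, 0}} (χ : L.Formula ℕ) : L.Formula ℕ :=
  (BoundedFormula.relabel (n := 1) (k := 0)
    (fun i => Nat.casesOn i (Sum.inr 0) Sum.inl : ℕ → ℕ ⊕ Fin 1) χ).ex

lemma realize_existsFormula {L : FirstOrder.Language.{0, 0}} {H : Type*} [L.Structure H]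
    (χ : L.Formula ℕ) (v : ℕ → H) :
    (existsFormula χ).Realize v ↔ ∃ x, χ.Realize (consEnv x v) := by
  unfold existsFormula Formula.Realize
  rw [BoundedFormula.realize_ex]
  refine exists_congr fun x => ?_
  rw [BoundedFormula.realize_relabel]
  have h1 : (Sum.elim v (Fin.snoc (default : Fin 0 → H) x ∘ Fin.castAdd 0) ∘
      (fun i => Nat.casesOn i (Sum.inr 0) Sum.inl : ℕ → ℕ ⊕ Fin 1)) = consEnv x v := by
    funext i
    cases i with
    | zero => simp [consEnv, Fin.snoc]
    | succ n => simp [consEnv]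
  rw [h1]
  exact iff_of_eq (congrArg _ (Subsingleton.elim _ _))

variable {θ : Cardinal.{0}}

/-- `P` is a predicate of assignments that some formula of set theory defines in `H(θ)`. -/
def FODef (P : (ℕ → HSet θ) → Prop) : Prop :=
  ∃ χ : setTheoryLanguage.Formula ℕ, ∀ v, χ.Realize v ↔ P v

namespace FODef

variable {P Q : (ℕ → HSet θ) → Prop}

lemma mem (i j : ℕ) : FODef (fun v : ℕ → HSet θ => (v i).1 ∈ (v j).1) :=
  ⟨Relations.formula₂ (show setTheoryLanguage.Relations 2 from SetTheoryRel.mem)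
    (Term.var i) (Term.var j), fun _ => Formula.realize_rel₂.trans Iff.rfl⟩

lemma eq (i j : ℕ) : FODef (fun v : ℕ → HSet θ => v i = v j) :=
  ⟨Term.equal (Term.var i) (Term.var j), fun v => by simp⟩

lemma not (hP : FODef P) : FODef (fun v => ¬ P v) :=
  hP.elim fun χ h => ⟨χ.not, fun v => by rw [Formula.realize_not, h]⟩

lemma and (hP : FODef P) (hQ : FODef Q) : FODef (fun v => P v ∧ Q v) := by
  obtain ⟨χ, h⟩ := hP
  obtain ⟨ξ, h'⟩ := hQ
  exact ⟨χ ⊓ ξ, fun v => by rw [Formula.realize_inf, h, h']⟩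

lemma or (hP : FODef P) (hQ : FODef Q) : FODef (fun v => P v ∨ Q v) := by
  obtain ⟨χ, h⟩ := hP
  obtain ⟨ξ, h'⟩ := hQ
  exact ⟨χ ⊔ ξ, fun v => by rw [Formula.realize_sup, h, h']⟩

lemma imp (hP : FODef P) (hQ : FODef Q) : FODef (fun v => P v → Q v) := by
  obtain ⟨χ, h⟩ := hP
  obtain ⟨ξ, h'⟩ := hQ
  exact ⟨χ.imp ξ, fun v => by rw [Formula.realize_imp, h, h']⟩

lemma iff (hP : FODef P) (hQ : FODef Q) : FODef (fun v => P v ↔ Q v) := by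
  simp_rw [iff_iff_implies_and_implies]
  exact (hP.imp hQ).and (hQ.imp hP)

/-- The bound variable takes the place of variable `0`, and the others are shifted by one. -/
lemma ex {R : HSet θ → (ℕ → HSet θ) → Prop}
    (hR : FODef (fun v => R (v 0) (fun n => v (n + 1)))) : FODef (fun v => ∃ x, R x v) := by
  obtain ⟨χ, h⟩ := hR
  exact ⟨existsFormula χ, fun v => by simp_rw [realize_existsFormula, h]; rfl⟩

lemma all {R : HSet θ → (ℕ → HSet θ) → Prop}
    (hR : FODef (fun v => R (v 0) (fun n => v (n + 1)))) : FODef (fun v => ∀ x, R x v) := by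
  have := (ex (R := fun x v => ¬ R x v) hR.not).not
  simpa only [not_exists, not_not] using this

end FODef

/-- An elementary submodel contains a witness for every property of a set that is definable from
parameters in it, provided that there is such a set at all. The witness is variable `0` and the
parameters are the next variables; the list of parameters is nonempty so that its head `a` can
serve as the value of all the unused variables. -/
lemma FODef.reflect {P : (ℕ → HSet θ) → Prop} (hP : FODef P)
    (S : setTheoryLanguage.ElementarySubstructure (HSet θ)) (l : List (HSet θ)) (a : HSet θ)
    (hl : ∀ y ∈ a :: l, y ∈ S) (h : ∃ x, P (fun n => (x :: a :: l).getD n a)) :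
    ∃ x ∈ S, P (fun n => (x :: a :: l).getD n a) := by
  obtain ⟨χ, hχ⟩ := hP
  have hv : ∀ n, (a :: l).getD n a ∈ S := by
    intro n
    rcases lt_or_ge n (a :: l).length with h | h
    · rw [List.getD_eq_getElem _ _ h]
      exact hl _ (List.getElem_mem h)
    · rw [List.getD_eq_default _ _ h]
      exact hl a List.mem_cons_self
  have henv : ∀ x : HSet θ,
      (fun n => (x :: a :: l).getD n a) = consEnv x (fun n => (a :: l).getD n a) := by
    intro x
    funext n
    cases n <;> rfl
  simp_rw [henv, ← hχ] at h ⊢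
  rw [← realize_existsFormula] at h
  have h2 := (S.subtype.map_formula (existsFormula χ)
    (fun n => (⟨(a :: l).getD n a, hv n⟩ : S))).1 h
  rw [realize_existsFormula] at h2
  obtain ⟨x, hx⟩ := h2
  refine ⟨x, x.2, ?_⟩
  rw [← S.subtype.map_formula] at hx
  convert hx using 1
  funext n
  cases n <;> rfl

end Definability

/-! ### Codes of mathematical objects, and hereditary cardinality -/

section Codes

lemma mem_codeSet {X : Type*} {code : X → ZFSet.{0}} {s : Set X} [Small.{0} s] {x : ZFSet.{0}} :
    x ∈ codeSet code s ↔ ∃ a ∈ s, code a = x := by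
  simp [codeSet]

lemma code_mem_codeSet {X : Type*} {code : X → ZFSet.{0}} (hc : code.Injective) {s : Set X}
    [Small.{0} s] {a : X} : code a ∈ codeSet code s ↔ a ∈ s := by
  rw [mem_codeSet]
  exact ⟨fun ⟨b, hb, h⟩ => hc h ▸ hb, fun h => ⟨a, h, rfl⟩⟩

lemma codeSet_injective {X : Type} {code : X → ZFSet.{0}} (hc : code.Injective) :
    Function.Injective (fun s : Set X => codeSet code s) := by
  intro s t h
  ext a
  rw [← code_mem_codeSet hc, ← code_mem_codeSet hc (s := t)]
  exact iff_of_eq (congrArg (code a ∈ ·) h)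

lemma codeOrd_injective : Function.Injective codeOrd := by
  intro a b h
  have := Ordinal.toZFSet_injective h
  exact Ordinal.ToType.mk.symm.injective (Subtype.ext this)

lemma codeOrd_mem_codeOrd {γ δ : Omega1} : codeOrd γ ∈ codeOrd δ ↔ γ < δ := by
  unfold codeOrd
  rw [Ordinal.toZFSet_mem_toZFSet_iff, Subtype.coe_lt_coe]
  exact Ordinal.ToType.mk.symm.lt_iff_lt

lemma mem_codeOrd {x : ZFSet.{0}} {δ : Omega1} : x ∈ codeOrd δ ↔ ∃ γ < δ, codeOrd γ = x := by
  constructor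
  · intro h
    obtain ⟨a, ha, rfl⟩ := Ordinal.mem_toZFSet_iff.1 h
    have h1 : a < ω₁ := ha.trans (Ordinal.ToType.toOrd δ).2
    have h2 : codeOrd (Ordinal.ToType.mk ⟨a, h1⟩) = a.toZFSet := by simp [codeOrd]
    rw [← h2] at h
    exact ⟨_, codeOrd_mem_codeOrd.1 h, h2⟩
  · rintro ⟨γ, h, rfl⟩
    exact codeOrd_mem_codeOrd.2 h

lemma mem_codeFinset {x : ZFSet.{0}} {F : Finset Omega1} :
    x ∈ codeFinset F ↔ ∃ γ ∈ F, codeOrd γ = x := mem_codeSet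

lemma codeOrd_mem_codeFinset {γ : Omega1} {F : Finset Omega1} :
    codeOrd γ ∈ codeFinset F ↔ γ ∈ F := code_mem_codeSet codeOrd_injective

lemma codeFinset_injective : Function.Injective codeFinset :=
  fun _ _ h => Finset.coe_injective (codeSet_injective codeOrd_injective h)

lemma mem_codeFamily {x : ZFSet.{0}} {𝓑 : Set (Finset Omega1)} :
    x ∈ codeFamily 𝓑 ↔ ∃ F ∈ 𝓑, codeFinset F = x := mem_codeSet

lemma codeFinset_mem_codeFamily {F : Finset Omega1} {𝓑 : Set (Finset Omega1)} :
    codeFinset F ∈ codeFamily 𝓑 ↔ F ∈ 𝓑 := code_mem_codeSet codeFinset_injective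

lemma codeReal_injective : Function.Injective codeReal := by
  intro r s h
  have hc : Function.Injective
      (fun q : ℚ => ((Encodable.encode q : ℕ) : Ordinal.{0}).toZFSet) := by
    intro p q h
    exact Encodable.encode_injective (Nat.cast_injective (Ordinal.toZFSet_injective h))
  have h1 := Set.ext_iff.1 (codeSet_injective hc h)
  refine le_antisymm ?_ ?_ <;> refine le_of_forall_rat_lt_imp_le fun q hq => ?_
  · exact ((h1 q).1 hq).le
  · exact ((h1 q).2 hq).le

lemma codeRealFinset_injective : Function.Injective codeRealFinset :=
  fun _ _ h => Finset.coe_injective (codeSet_injective codeReal_injective h)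

/-- The code of a family of finite sets of reals. -/
noncomputable def codeRealFamily (W : Set (Finset ℝ)) : ZFSet.{0} := codeSet codeRealFinset W

lemma codeRealFinset_mem {H : Finset ℝ} {W : Set (Finset ℝ)} :
    codeRealFinset H ∈ codeRealFamily W ↔ H ∈ W := code_mem_codeSet codeRealFinset_injective

lemma mem_codeRatStars {x : ZFSet.{0}} :
    x ∈ codeRatStars ↔ ∃ W ∈ ratStars, codeRealFamily W = x := mem_codeSet

lemma pair_mem_codeFun {s : Set Omega1} {f : Omega1 → ZFSet.{0}} {γ : Omega1} {y : ZFSet.{0}} :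
    ZFSet.pair (codeOrd γ) y ∈ codeFun s f ↔ γ ∈ s ∧ f γ = y := by
  unfold codeFun
  rw [mem_codeSet]
  constructor
  · rintro ⟨a, ha, h⟩
    obtain ⟨h1, h2⟩ := ZFSet.pair_inj.1 h
    obtain rfl := codeOrd_injective h1
    exact ⟨ha, h2⟩
  · rintro ⟨h, rfl⟩
    exact ⟨γ, h, rfl⟩

lemma mem_codeFun {s : Set Omega1} {f : Omega1 → ZFSet.{0}} {p : ZFSet.{0}} :
    p ∈ codeFun s f ↔ ∃ γ ∈ s, ZFSet.pair (codeOrd γ) (f γ) = p := mem_codeSet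

/-- The transitive closure of a set. -/
def tclosure (x : ZFSet.{0}) : Set ZFSet.{0} :=
  {y | Relation.TransGen (fun a b : ZFSet.{0} => a ∈ b) y x}

lemma tclosure_subset {x y : ZFSet.{0}} (h : y ∈ x) : tclosure y ⊆ tclosure x :=
  fun _ hz => hz.tail h

lemma mem_tclosure {x z : ZFSet.{0}} :
    z ∈ tclosure x ↔ ∃ y ∈ x, z = y ∨ z ∈ tclosure y := by
  constructor
  · intro h
    rcases Relation.transGen_iff _ _ _ |>.1 h with h | ⟨y, h1, h2⟩
    · exact ⟨z, h, Or.inl rfl⟩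
    · obtain h3 := Relation.TransGen.tail'_iff.1 h
      obtain ⟨c, hc, hcx⟩ := h3
      refine ⟨c, hcx, ?_⟩
      rcases Relation.reflTransGen_iff_eq_or_transGen.1 hc with h | h
      · exact Or.inl h.symm
      · exact Or.inr h
  · rintro ⟨y, hy, rfl | h⟩
    · exact Relation.TransGen.single hy
    · exact tclosure_subset hy h

/-- The transitive closure of `x` has at most `μ` elements. The lift is due to `ZFSet.{0}` living
in a universe above that of `μ`. -/
def HCardLE (μ : Cardinal.{0}) (x : ZFSet.{0}) : Prop := #(tclosure x) ≤ Cardinal.lift.{1} μ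

variable {μ : Cardinal.{0}}

lemma HCardLE.of_mem {x y : ZFSet.{0}} (hx : HCardLE μ x) (h : y ∈ x) : HCardLE μ y :=
  (Cardinal.mk_le_mk_of_subset (tclosure_subset h)).trans hx

lemma HCardLE.codeSet (hμ : ℵ₀ ≤ μ) {X : Type} {code : X → ZFSet.{0}} {s : Set X} (hs : #s ≤ μ)
    (hc : ∀ a ∈ s, HCardLE μ (code a)) : HCardLE μ (codeSet code s) := by
  have h1 : tclosure (_root_.codeSet code s) ⊆
      ⋃ a : ULift.{1} s, insert (code a.down) (tclosure (code a.down)) := by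
    intro z hz
    obtain ⟨y, hy, h⟩ := mem_tclosure.1 hz
    obtain ⟨a, ha, rfl⟩ := mem_codeSet.1 hy
    exact mem_iUnion.2 ⟨⟨⟨a, ha⟩⟩, h⟩
  have hμ' : ℵ₀ ≤ Cardinal.lift.{1} μ := by simpa using hμ
  refine (Cardinal.mk_le_mk_of_subset h1).trans ((Cardinal.mk_iUnion_le _).trans ?_)
  refine (mul_le_mul' (?_ : _ ≤ Cardinal.lift.{1} μ)
    (?_ : _ ≤ Cardinal.lift.{1} μ)).trans (Cardinal.mul_eq_self hμ').le
  · simpa using hs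
  · refine ciSup_le' fun a => (Cardinal.mk_insert_le).trans ?_
    exact Cardinal.add_le_of_le hμ' (hc _ a.down.2) (Cardinal.one_le_aleph0.trans hμ')

lemma tclosure_insert (x y : ZFSet.{0}) :
    tclosure (insert x y) = insert x (tclosure x ∪ tclosure y) := by
  ext z
  rw [mem_tclosure]
  simp only [ZFSet.mem_insert_iff, exists_eq_or_imp, mem_insert_iff, mem_union]
  rw [← mem_tclosure (x := y), or_assoc]

lemma tclosure_empty : tclosure ∅ = ∅ := by
  ext z
  rw [mem_tclosure]
  simp

lemma HCardLE.insert (hμ : ℵ₀ ≤ μ) {x y : ZFSet.{0}} (hx : HCardLE μ x) (hy : HCardLE μ y) :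
    HCardLE μ (insert x y) := by
  have hμ' : ℵ₀ ≤ Cardinal.lift.{1} μ := by simpa using hμ
  unfold HCardLE
  rw [tclosure_insert]
  refine (Cardinal.mk_insert_le).trans (Cardinal.add_le_of_le hμ' ?_
    (Cardinal.one_le_aleph0.trans hμ'))
  exact (Cardinal.mk_union_le _ _).trans (Cardinal.add_le_of_le hμ' hx hy)

lemma HCardLE.empty : HCardLE μ ∅ := by
  simp [HCardLE, tclosure_empty]

lemma HCardLE.pair (hμ : ℵ₀ ≤ μ) {x y : ZFSet.{0}} (hx : HCardLE μ x) (hy : HCardLE μ y) :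
    HCardLE μ (ZFSet.pair x y) :=
  have h1 : HCardLE μ {x} := hx.insert hμ HCardLE.empty
  have h2 : HCardLE μ {y} := hy.insert hμ HCardLE.empty
  have h3 : HCardLE μ {{x, y}} := (hx.insert hμ h2).insert hμ HCardLE.empty
  h1.insert hμ h3

lemma HCardLE.codeOrd (hμ : ℵ₁ ≤ μ) (γ : Omega1) : HCardLE μ (codeOrd γ) := by
  induction γ using WellFoundedLT.induction with
  | _ γ ih =>
    have : _root_.codeOrd γ = _root_.codeSet _root_.codeOrd (Iio γ) := by
      ext x
      rw [mem_codeOrd, mem_codeSet]; rfl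
    rw [this]
    refine HCardLE.codeSet ((Cardinal.aleph0_le_aleph 1).trans hμ) ?_ ih
    exact (Cardinal.mk_set_le _).trans (mk_omega1.le.trans hμ)

lemma HCardLE.codeFinset (hμ : ℵ₁ ≤ μ) (F : Finset Omega1) : HCardLE μ (codeFinset F) :=
  HCardLE.codeSet ((Cardinal.aleph0_le_aleph 1).trans hμ)
    ((Cardinal.mk_set_le _).trans (mk_omega1.le.trans hμ)) fun γ _ => HCardLE.codeOrd hμ γ

lemma HCardLE.codeFamily (hμ : ℵ₁ ≤ μ) (𝓑 : Set (Finset Omega1)) : HCardLE μ (codeFamily 𝓑) := by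
  refine HCardLE.codeSet ((Cardinal.aleph0_le_aleph 1).trans hμ) ?_
    fun F _ => HCardLE.codeFinset hμ F
  refine (Cardinal.mk_set_le _).trans ?_
  rw [Cardinal.mk_finset_of_infinite, mk_omega1]
  exact hμ

lemma HCardLE.codeFun (hμ : ℵ₁ ≤ μ) {s : Set Omega1} {f : Omega1 → ZFSet.{0}}
    (hf : ∀ γ, HCardLE μ (f γ)) : HCardLE μ (codeFun s f) :=
  have hμ' := (Cardinal.aleph0_le_aleph 1).trans hμ
  HCardLE.codeSet hμ' ((Cardinal.mk_set_le _).trans (mk_omega1.le.trans hμ))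
    fun γ _ => (HCardLE.codeOrd hμ γ).pair hμ' (hf γ)

lemma HCardLE.natCast_toZFSet (hμ : ℵ₀ ≤ μ) (n : ℕ) :
    HCardLE μ ((n : Ordinal.{0}).toZFSet) := by
  induction n with
  | zero => simpa using HCardLE.empty
  | succ n ih =>
    rw [Nat.cast_succ, Ordinal.toZFSet_add_one]
    exact ih.insert hμ ih

lemma HCardLE.codeRealFinset (hμ : ℵ₀ ≤ μ) (H : Finset ℝ) : HCardLE μ (codeRealFinset H) := by
  refine HCardLE.codeSet hμ ?_ fun r _ => HCardLE.codeSet hμ ?_ fun q _ =>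
    HCardLE.natCast_toZFSet hμ _
  · exact (Cardinal.mk_le_aleph0_iff.2 H.countable_toSet).trans hμ
  · exact (Cardinal.mk_set_le _).trans ((Cardinal.mk_le_aleph0_iff.2 inferInstance).trans hμ)

lemma ratStars_countable : ratStars.Countable := by
  refine (countable_range fun I : Finset (ℚ × ℚ) =>
    starSet (⋃ p ∈ I, Ioo (p.1 : ℝ) (p.2 : ℝ))).mono ?_
  rintro _ ⟨I, _, _, rfl⟩
  exact ⟨I, rfl⟩

lemma HCardLE.codeRatStars (hμ : 𝔠 ≤ μ) : HCardLE μ codeRatStars := by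
  have hμ' := Cardinal.aleph0_le_continuum.trans hμ
  refine HCardLE.codeSet hμ' ((Cardinal.mk_le_aleph0_iff.2 ratStars_countable).trans hμ')
    fun W _ => HCardLE.codeSet hμ' ?_ fun H _ => HCardLE.codeRealFinset hμ' H
  refine (Cardinal.mk_set_le _).trans ?_
  rw [Cardinal.mk_finset_of_infinite, Cardinal.mk_real]
  exact hμ

/-- A set belongs to `H(θ)` if its transitive closure has at most `μ < θ` elements. -/
lemma HCardLE.lt {θ : Cardinal.{0}} {x : ZFSet.{0}} (hx : HCardLE μ x) (hμ : μ < θ) :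
    #(tclosure x) < Cardinal.lift.{1} θ :=
  hx.trans_lt (Cardinal.lift_lt.2 hμ)

end Codes

/-! ### Countable elementary submodels of `H(θ)` -/

section Submodels

variable {θ : Cardinal.{0}}

/-- A member of a member of `H(θ)`, as a member of `H(θ)`. -/
def HSet.ofMem (x : HSet θ) {y : ZFSet.{0}} (h : y ∈ x.1) : HSet θ :=
  ⟨y, (Cardinal.mk_le_mk_of_subset (tclosure_subset h)).trans_lt x.2⟩

/-- A set with transitive closure of size at most `μ < θ`, as a member of `H(θ)`. -/
def HSet.ofLE {μ : Cardinal.{0}} (hμ : μ < θ) {x : ZFSet.{0}} (hx : HCardLE μ x) : HSet θ :=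
  ⟨x, hx.lt hμ⟩

lemma HSet.ext_mem {x y : HSet θ} (h : ∀ w : HSet θ, w.1 ∈ x.1 ↔ w.1 ∈ y.1) : x = y := by
  refine Subtype.ext (ZFSet.ext fun z => ⟨fun hz => ?_, fun hz => ?_⟩)
  · exact (h (x.ofMem hz)).1 hz
  · exact (h (y.ofMem hz)).2 hz

lemma HSet.ext_iff_val (x y : HSet θ) : x = y ↔ x.1 = y.1 := Subtype.ext_iff

lemma HSet.eq_singleton_iff (z x : HSet θ) : (∀ w : HSet θ, w.1 ∈ z.1 ↔ w = x) ↔ z.1 = {x.1} := by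
  constructor
  · intro h
    ext t
    rw [ZFSet.mem_singleton]
    refine ⟨fun ht => congrArg Subtype.val ((h (z.ofMem ht)).1 ht), fun ht => ?_⟩
    rw [ht]
    exact (h x).2 rfl
  · intro h w
    rw [h, ZFSet.mem_singleton, HSet.ext_iff_val]

lemma HSet.eq_pair_iff (z x y : HSet θ) :
    (∀ w : HSet θ, w.1 ∈ z.1 ↔ (w = x ∨ w = y)) ↔ z.1 = {x.1, y.1} := by
  constructor
  · intro h
    ext t
    rw [ZFSet.mem_pair]
    constructor
    · intro ht
      exact ((h (z.ofMem ht)).1 ht).imp (congrArg Subtype.val) (congrArg Subtype.val)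
    · rintro (rfl | rfl)
      · exact (h x).2 (Or.inl rfl)
      · exact (h y).2 (Or.inr rfl)
  · intro h w
    rw [h, ZFSet.mem_pair, HSet.ext_iff_val, HSet.ext_iff_val]

/-- The Kuratowski description of ordered pairs, with all quantifiers bounded to `H(θ)`. -/
lemma HSet.eq_orderedPair_iff (p x y : HSet θ) :
    p.1 = ZFSet.pair x.1 y.1 ↔ (∃ a : HSet θ, a.1 ∈ p.1 ∧ ∀ w : HSet θ, w.1 ∈ a.1 ↔ w = x) ∧
      (∃ b : HSet θ, b.1 ∈ p.1 ∧ ∀ w : HSet θ, w.1 ∈ b.1 ↔ (w = x ∨ w = y)) ∧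
      ∀ z : HSet θ, z.1 ∈ p.1 → (∀ w : HSet θ, w.1 ∈ z.1 ↔ w = x) ∨
        ∀ w : HSet θ, w.1 ∈ z.1 ↔ (w = x ∨ w = y) := by
  simp only [HSet.eq_singleton_iff, HSet.eq_pair_iff]
  constructor
  · intro h
    have h1 : ({x.1} : ZFSet) ∈ p.1 := by rw [h]; simp [ZFSet.pair]
    have h2 : ({x.1, y.1} : ZFSet) ∈ p.1 := by rw [h]; simp [ZFSet.pair]
    refine ⟨⟨p.ofMem h1, h1, rfl⟩, ⟨p.ofMem h2, h2, rfl⟩, fun z hz => ?_⟩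
    rw [h] at hz
    simpa [ZFSet.pair] using hz
  · rintro ⟨⟨a, ha, ha'⟩, ⟨b, hb, hb'⟩, h⟩
    ext t
    simp only [ZFSet.pair, ZFSet.mem_pair]
    constructor
    · intro ht
      exact h (p.ofMem ht) ht
    · rintro (rfl | rfl)
      · rwa [← ha']
      · rwa [← hb']

namespace FODef

lemma pair (i j k : ℕ) :
    FODef (fun v : ℕ → HSet θ => (v i).1 = ZFSet.pair (v j).1 (v k).1) := by
  simp_rw [HSet.eq_orderedPair_iff]
  apply_rules [FODef.mem, FODef.eq, FODef.and, FODef.or, FODef.iff, FODef.imp, FODef.ex, FODef.all,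
    FODef.not]

lemma pair_mem (i j k : ℕ) :
    FODef (fun v : ℕ → HSet θ => ZFSet.pair (v i).1 (v j).1 ∈ (v k).1) := by
  have h : ∀ v : ℕ → HSet θ, ZFSet.pair (v i).1 (v j).1 ∈ (v k).1 ↔
      ∃ p : HSet θ, p.1 = ZFSet.pair (v i).1 (v j).1 ∧ p.1 ∈ (v k).1 := by
    intro v
    refine ⟨fun hp => ⟨(v k).ofMem hp, rfl, hp⟩, ?_⟩
    rintro ⟨p, hp, hpk⟩
    rwa [← hp]
  simp_rw [h]
  exact FODef.ex ((FODef.pair _ _ _).and (FODef.mem _ _))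

end FODef

lemma HSet.exists_of_pair_mem (x : HSet θ) {a b : ZFSet.{0}} (h : ZFSet.pair a b ∈ x.1) :
    ∃ y z : HSet θ, y.1 = a ∧ z.1 = b := by
  have h1 : ({a, b} : ZFSet) ∈ ZFSet.pair a b := by simp [ZFSet.pair]
  exact ⟨((x.ofMem h).ofMem h1).ofMem (y := a) (by simp [HSet.ofMem]),
    ((x.ofMem h).ofMem h1).ofMem (y := b) (by simp [HSet.ofMem]), rfl, rfl⟩

/-- `S` is an elementary submodel of `H(θ)` with `S ∩ ω₁ = α`, and `u ∈ S` is a function with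
domain `ω₁`, by means of which `S` can refer to `ω₁`. -/
structure IsSubmodelAt (S : setTheoryLanguage.ElementarySubstructure (HSet θ)) (α : Omega1)
    (u : HSet θ) : Prop where
  mem_u : u ∈ S
  eq_codeFun : ∃ f, u.1 = codeFun univ f
  ord_mem_iff : ∀ (x : HSet θ) (γ : Omega1), x.1 = codeOrd γ → (x ∈ S ↔ γ < α)

namespace IsSubmodelAt

variable {S : setTheoryLanguage.ElementarySubstructure (HSet θ)} {α : Omega1} {u : HSet θ}

lemma exists_ord (h : IsSubmodelAt S α u) (γ : Omega1) : ∃ x : HSet θ, x.1 = codeOrd γ := by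
  obtain ⟨f, hf⟩ := h.eq_codeFun
  have h1 : ZFSet.pair (codeOrd γ) (f γ) ∈ u.1 := by
    rw [hf, pair_mem_codeFun]
    exact ⟨mem_univ _, rfl⟩
  obtain ⟨y, _, hy, _⟩ := u.exists_of_pair_mem h1
  exact ⟨y, hy⟩

lemma exists_ord_mem (h : IsSubmodelAt S α u) {γ : Omega1} (hγ : γ < α) :
    ∃ x ∈ S, x.1 = codeOrd γ := by
  obtain ⟨x, hx⟩ := h.exists_ord γ
  exact ⟨x, (h.ord_mem_iff x γ hx).2 hγ, hx⟩

/-- The domain of `u` is `ω₁`, so being a countable ordinal is definable from `u`. -/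
lemma dom_iff (h : IsSubmodelAt S α u) (x : HSet θ) :
    (∃ y : HSet θ, ZFSet.pair x.1 y.1 ∈ u.1) ↔ ∃ γ, x.1 = codeOrd γ := by
  obtain ⟨f, hf⟩ := h.eq_codeFun
  constructor
  · rintro ⟨y, hy⟩
    rw [hf] at hy
    obtain ⟨γ, _, hγ⟩ := mem_codeFun.1 hy
    exact ⟨γ, (ZFSet.pair_inj.1 hγ).1.symm⟩
  · rintro ⟨γ, hγ⟩
    have h1 : ZFSet.pair (codeOrd γ) (f γ) ∈ u.1 := by
      rw [hf, pair_mem_codeFun]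
      exact ⟨mem_univ _, rfl⟩
    obtain ⟨_, y, _, hy⟩ := u.exists_of_pair_mem h1
    exact ⟨y, by rw [hγ, hy]; exact h1⟩

/-- Finite subsets of `α = S ∩ ω₁` belong to `S`, because `S` is closed under the operation
`(γ, G) ↦ G ∪ {γ}`. -/
lemma codeFinset_mem (h : IsSubmodelAt S α u) (hθ : ℵ₁ < θ) (G : Finset Omega1)
    (hG : ∀ γ ∈ G, γ < α) : ∃ x ∈ S, x.1 = codeFinset G := by
  induction G using Finset.induction_on with
  | empty =>
    obtain ⟨x, hx, hx'⟩ := FODef.reflect (P := fun v : ℕ → HSet θ => ∀ t : HSet θ, ¬ t.1 ∈ (v 0).1)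
      (by apply_rules [FODef.all, FODef.not, FODef.mem]) S [] u (by simpa using h.mem_u)
      ⟨HSet.ofLE hθ (HCardLE.codeFinset le_rfl ∅), fun t => by
        change ¬ t.1 ∈ codeFinset ∅
        simp [mem_codeFinset]⟩
    refine ⟨x, hx, ?_⟩
    ext z
    constructor
    · intro hz
      exact absurd hz (hx' (x.ofMem hz))
    · simp [mem_codeFinset]
  | insert γ G _ ih =>
    simp only [Finset.mem_insert, forall_eq_or_imp] at hG
    obtain ⟨y, hy, hy'⟩ := ih hG.2
    obtain ⟨c, hc, hc'⟩ := h.exists_ord_mem hG.1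
    obtain ⟨x, hx, hx'⟩ := FODef.reflect
      (P := fun v : ℕ → HSet θ => ∀ t : HSet θ, t.1 ∈ (v 0).1 ↔ (t = v 1 ∨ t.1 ∈ (v 2).1))
      (by apply_rules [FODef.all, FODef.iff, FODef.or, FODef.eq, FODef.mem]) S [y] c
      (by simp [hy, hc])
      ⟨HSet.ofLE hθ (HCardLE.codeFinset le_rfl (insert γ G)), fun t => by
        change t.1 ∈ codeFinset (insert γ G) ↔ t = c ∨ t.1 ∈ y.1
        rw [hy', HSet.ext_iff_val, hc', mem_codeFinset, mem_codeFinset]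
        simp [eq_comm]⟩
    refine ⟨x, hx, congrArg Subtype.val (?_ : x = HSet.ofLE hθ
      (HCardLE.codeFinset le_rfl (insert γ G)))⟩
    refine HSet.ext_mem fun w => (hx' w).trans ?_
    change w = c ∨ w.1 ∈ y.1 ↔ w.1 ∈ codeFinset (insert γ G)
    rw [hy', HSet.ext_iff_val, hc', mem_codeFinset, mem_codeFinset]
    simp [eq_comm]

/-- A countable element of `S` is a subset of `S`: by elementarity it is the image of a countable
ordinal `δ ∈ S` under a function in `S`, and `δ ⊆ S` because `S ∩ ω₁` is an ordinal. -/
lemma mem_of_mem_countable (h : IsSubmodelAt S α u) {μ : Cardinal.{0}} (hμ : ℵ₁ ≤ μ) (hθ : μ < θ)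
    {c x : HSet θ} (hc : c ∈ S) (hcμ : HCardLE μ c.1) (hcc : {y | y ∈ c.1}.Countable)
    (hx : x.1 ∈ c.1) : x ∈ S := by
  obtain ⟨i, hi⟩ : ∃ i : ZFSet.{0} → Omega1, InjOn i {y | y ∈ c.1} := by
    obtain ⟨e, he⟩ := countable_iff_exists_injOn.1 hcc
    let k : ℕ ↪ Omega1 := Infinite.natEmbedding Omega1
    exact ⟨k ∘ e, k.injective.comp_injOn he⟩
  obtain ⟨δ, hδ⟩ := exists_gt_of_countable (hcc.image i)
  -- the inverse `j` of the injection `i`, restricted to the range `s` of `i`, maps a subset of `δ`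
  -- onto `c`
  let s : Set Omega1 := i '' {y | y ∈ c.1}
  let j : Omega1 → ZFSet.{0} := Function.invFunOn i {y | y ∈ c.1}
  have hj : ∀ y ∈ c.1, j (i y) = y := fun y hy => hi.leftInvOn_invFunOn hy
  obtain ⟨d, hd⟩ := h.exists_ord δ
  have hf : HCardLE μ (codeFun s j) := by
    refine HCardLE.codeSet ((Cardinal.aleph0_le_aleph 1).trans hμ)
      ((Cardinal.mk_set_le _).trans (mk_omega1.le.trans hμ)) ?_
    rintro _ ⟨y, hy, rfl⟩
    refine (HCardLE.codeOrd hμ _).pair ((Cardinal.aleph0_le_aleph 1).trans hμ) ?_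
    rw [hj y hy]
    exact hcμ.of_mem hy
  -- `d` is a countable ordinal, and `f` is a function that maps a part of `d` onto `c`
  let Q : HSet θ → HSet θ → HSet θ → Prop := fun f d c =>
    (∀ y z z' : HSet θ, ZFSet.pair y.1 z.1 ∈ f.1 → ZFSet.pair y.1 z'.1 ∈ f.1 → z = z') ∧
      ∀ z : HSet θ, z.1 ∈ c.1 → ∃ y : HSet θ, y.1 ∈ d.1 ∧ ZFSet.pair y.1 z.1 ∈ f.1
  have hQ : Q (HSet.ofLE hθ hf) d c := by
    constructor
    · intro y z z' h1 h2
      obtain ⟨γ, _, hγ⟩ := mem_codeFun.1 h1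
      obtain ⟨γ', _, hγ'⟩ := mem_codeFun.1 h2
      obtain ⟨e1, e2⟩ := ZFSet.pair_inj.1 hγ
      obtain ⟨e3, e4⟩ := ZFSet.pair_inj.1 hγ'
      obtain rfl := codeOrd_injective (e1.trans e3.symm)
      exact Subtype.ext (e2.symm.trans e4)
    · intro z hz
      have h1 : i z.1 < δ := hδ _ ⟨z.1, hz, rfl⟩
      refine ⟨d.ofMem (y := codeOrd (i z.1)) (by rw [hd]; exact codeOrd_mem_codeOrd.2 h1), ?_, ?_⟩
      · change codeOrd (i z.1) ∈ d.1
        rw [hd]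
        exact codeOrd_mem_codeOrd.2 h1
      · exact pair_mem_codeFun.2 ⟨⟨z.1, hz, rfl⟩, hj _ hz⟩
  obtain ⟨d, hdS, hdu, f, hf⟩ := FODef.reflect
    (P := fun v : ℕ → HSet θ => (∃ y : HSet θ, ZFSet.pair (v 0).1 y.1 ∈ (v 1).1) ∧
      ∃ f : HSet θ, Q f (v 0) (v 2))
    (by apply_rules [FODef.ex, FODef.all, FODef.and, FODef.imp, FODef.eq, FODef.mem,
      FODef.pair_mem]) S [c] u (by simp [hc, h.mem_u])
    ⟨d, (h.dom_iff d).2 ⟨δ, hd⟩, _, hQ⟩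
  -- now `d` and `f` may be taken in `S`, first the ordinal and then the function
  obtain ⟨δ, hδ⟩ := (h.dom_iff d).1 hdu
  obtain ⟨f, hfS, hf, hf'⟩ := FODef.reflect (P := fun v : ℕ → HSet θ => Q (v 0) (v 1) (v 2))
    (by apply_rules [FODef.ex, FODef.all, FODef.and, FODef.imp, FODef.eq, FODef.mem,
      FODef.pair_mem]) S [c] d (by simp [hc, hdS]) ⟨f, hf⟩
  obtain ⟨y, hyd, hyx⟩ := hf' x hx
  have hyd' : y.1 ∈ codeOrd δ := by rw [← hδ]; exact hyd
  obtain ⟨γ, hγ, hγy⟩ := mem_codeOrd.1 hyd'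
  have hyS : y ∈ S := (h.ord_mem_iff y γ hγy.symm).2
    (hγ.trans ((h.ord_mem_iff d δ hδ).1 hdS))
  obtain ⟨z, hzS, hz⟩ := FODef.reflect
    (P := fun v : ℕ → HSet θ => ZFSet.pair (v 2).1 (v 0).1 ∈ (v 1).1)
    (FODef.pair_mem _ _ _) S [y] f (by simp [hfS, hyS]) ⟨x, hyx⟩
  exact hf y x z hyx hz ▸ hzS

end IsSubmodelAt

end Submodels

/-! ### Finite unions of rational intervals -/

/-- Every open set that contains a finite set `H` of reals contains a finite union of disjoint
rational intervals that contains `H`. -/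
lemma exists_ratStar (H : Finset ℝ) {O : Set ℝ} (hO : IsOpen O) (h : (H : Set ℝ) ⊆ O) :
    ∃ W ∈ ratStars, H ∈ W ∧ W ⊆ starSet O := by
  have h1 : ∀ᶠ ε in 𝓝[>] (0 : ℝ), ∀ p ∈ H, Metric.ball p ε ⊆ O := by
    rw [Filter.eventually_all_finset]
    intro p hp
    obtain ⟨ε, hε, hb⟩ := Metric.isOpen_iff.1 hO p (h hp)
    filter_upwards [Ioo_mem_nhdsGT hε] with δ hδ
    exact (Metric.ball_subset_ball hδ.2.le).trans hb
  have h2 : ∀ᶠ ε in 𝓝[>] (0 : ℝ), ∀ p ∈ H, ∀ q ∈ H, p ≠ q → ε + ε ≤ dist p q := by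
    simp_rw [Filter.eventually_all_finset, Filter.eventually_imp_distrib_left]
    intro p _ q _ hpq
    filter_upwards [Ioo_mem_nhdsGT (half_pos (dist_pos.2 hpq))] with δ hδ
    linarith [hδ.2]
  obtain ⟨ε, ⟨hb, hd⟩, hε⟩ := ((h1.and h2).and self_mem_nhdsWithin).exists
  replace hε : 0 < ε := hε
  have ha : ∀ p : ℝ, ∃ a : ℚ, p - ε < a ∧ (a : ℝ) < p := fun p => exists_rat_btwn (by linarith)
  have hb' : ∀ p : ℝ, ∃ a : ℚ, p < a ∧ (a : ℝ) < p + ε := fun p => exists_rat_btwn (by linarith)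
  choose a ha ha' using ha
  choose b hb₁ hb₂ using hb'
  have hsub : ∀ p : ℝ, Ioo (a p : ℝ) (b p) ⊆ Metric.ball p ε := by
    intro p x hx
    rw [Real.ball_eq_Ioo]
    exact ⟨(ha p).trans hx.1, hx.2.trans (hb₂ p)⟩
  refine ⟨_, ⟨H.image fun p => (a p, b p), ?_, ?_, rfl⟩, ?_, ?_⟩
  · intro x hx
    obtain ⟨p, _, rfl⟩ := Finset.mem_image.1 hx
    exact_mod_cast (ha' p).trans (hb₁ p)
  · intro x hx y hy hne
    obtain ⟨p, hp, rfl⟩ := Finset.mem_image.1 hx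
    obtain ⟨q, hq, rfl⟩ := Finset.mem_image.1 hy
    have hpq : p ≠ q := by rintro rfl; exact hne rfl
    exact (Metric.ball_disjoint_ball (hd p hp q hq hpq)).mono (hsub p) (hsub q)
  · intro p hp
    simp only [Finset.mem_image, mem_iUnion]
    exact ⟨(a p, b p), ⟨p, hp, rfl⟩, ha' p, hb₁ p⟩
  · intro F hF x hx
    have := hF hx
    simp only [Finset.mem_image, mem_iUnion] at this
    obtain ⟨_, ⟨p, hp, rfl⟩, hxp⟩ := this
    exact hb p hp (hsub p hxp)

lemma ratStars_inter {W W' : Set (Finset ℝ)} (hW : W ∈ ratStars) (hW' : W' ∈ ratStars)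
    {H : Finset ℝ} (h : H ∈ W) (h' : H ∈ W') : ∃ W'' ∈ ratStars, H ∈ W'' ∧ W'' ⊆ W ∩ W' := by
  obtain ⟨I, -, -, rfl⟩ := hW
  obtain ⟨J, -, -, rfl⟩ := hW'
  have hI : ∀ I : Finset (ℚ × ℚ), IsOpen (⋃ p ∈ I, Ioo (p.1 : ℝ) (p.2 : ℝ)) := fun I =>
    isOpen_biUnion fun _ _ => isOpen_Ioo
  obtain ⟨W, hW, hHW, hWs⟩ := exists_ratStar H ((hI I).inter (hI J)) (subset_inter h h')
  exact ⟨W, hW, hHW, fun F hF => subset_inter_iff.1 (hWs hF)⟩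

/-! ### What a guessing model reflects -/

/-- The set `{x : h x ∈ W} ∩ ⋂ {u γ : γ ∈ G}`. These are the basic open sets of the topologies
with a subbase of the form `{u γ} ∪ {h⁻¹(W) : W ∈ 𝒲}`. -/
def basicNbhd (u : Omega1 → Set Omega1) (h : Omega1 → Finset ℝ) (G : Finset Omega1)
    (W : Set (Finset ℝ)) : Set Omega1 :=
  {x | (∀ γ ∈ G, x ∈ u γ) ∧ h x ∈ W}

/-- The combinatorial content of a guessing model at `α`. The uncountable disjoint family `𝓑`, the
map `ψ` and the sets `V γ` are objects of the model that extend `B α`, `h ↾ α` and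
`u γ ∩ α`. Two kinds of existential statements about members of `𝓑` reflect to `B α`. -/
structure Reflection (B : Omega1 → Set (Finset Omega1)) (α : Omega1) (u : Omega1 → Set Omega1)
    (h : Omega1 → Finset ℝ) (𝓑 : Set (Finset Omega1)) (ψ : Omega1 → Finset ℝ)
    (V : Omega1 → Set Omega1) : Prop where
  not_countable : ¬ 𝓑.Countable
  pairwiseDisjoint : 𝓑.PairwiseDisjoint id
  nonempty : ∀ x, (ψ x).Nonempty
  disjoint : ∀ x y, x ≠ y → Disjoint (ψ x) (ψ y)
  reflect_nbhd : ∀ G : Finset Omega1, (∀ γ ∈ G, γ < α) → ∀ W ∈ ratStars,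
    ∀ L ∈ 𝓑, (L : Set Omega1) ⊆ basicNbhd V ψ G W →
      ∃ L ∈ B α, (L : Set Omega1) ⊆ basicNbhd u h G W
  reflect_cover : ∀ β < α, B β ⊆ finsetsBelow β →
    ∀ G : Finset Omega1, (∀ γ ∈ G, γ < α) → ∀ W ∈ ratStars,
    ∀ K : Finset Omega1, (∀ γ ∈ K, γ < α) → ∀ L ∈ 𝓑, (∀ x ∈ L, β < x) →
      (∀ F ∈ B β, (F : Set Omega1) ⊆ basicNbhd u h G W → (∀ γ ∈ F, (K : Set Omega1) ⊆ u γ) →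
        ∃ γ ∈ F, ∃ x ∈ L, x ∉ V γ) →
      ∃ L ∈ B α, (∀ x ∈ L, β < x) ∧
        ∀ F ∈ B β, (F : Set Omega1) ⊆ basicNbhd u h G W → (∀ γ ∈ F, (K : Set Omega1) ⊆ u γ) →
          ∃ γ ∈ F, ∃ x ∈ L, x ∉ u γ

lemma IsFinsetDiamondSeq.exists_mem {B : Omega1 → Set (Finset Omega1)} (hB : IsFinsetDiamondSeq B)
    (F : Finset Omega1) : ∃ β, F ∈ B β := by
  have hun : ¬ (univ : Set (Finset Omega1)).Countable := by
    intro h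
    refine not_countable_univ ((h.preimage (f := fun x : Omega1 => ({x} : Finset Omega1))
      Finset.singleton_injective).mono (subset_univ _) : (univ : Set Omega1).Countable)
  obtain ⟨b, hb⟩ := exists_gt_of_countable F.countable_toSet
  obtain ⟨β, h1, h2⟩ := hB univ hun (isClub_closed_finset fun _ => b)
  have hbβ : b < β := h2 ∅ (by simp)
  refine ⟨β, ?_⟩
  rw [← h1]
  exact ⟨mem_univ _, fun x hx => (hb x hx).trans hbβ⟩

section

variable {B : Omega1 → Set (Finset Omega1)} {U : Omega1 → Omega1 → Set Omega1}
  {φ : Omega1 → Omega1 → Finset ℝ} {α : Omega1} {κ θ : Cardinal.{0}} {M : Set ZFSet.{0}}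

/-- For a function `v`, `x ∈ v(γ)`. -/
def HSet.MemValue (v γ x : HSet θ) : Prop :=
  ∃ y : HSet θ, ZFSet.pair γ.1 y.1 ∈ v.1 ∧ x.1 ∈ y.1

/-- The relation `x ∈ basicNbhd v g G W` inside `H(θ)`. -/
def HSet.InBasic (v g G W x : HSet θ) : Prop :=
  (∀ γ : HSet θ, γ.1 ∈ G.1 → HSet.MemValue v γ x) ∧
    ∃ y : HSet θ, y.1 ∈ W.1 ∧ ZFSet.pair x.1 y.1 ∈ g.1

lemma FODef.memValue (i j k : ℕ) :
    FODef (fun w : ℕ → HSet θ => HSet.MemValue (w i) (w j) (w k)) :=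
  FODef.ex ((FODef.pair_mem _ _ _).and (FODef.mem _ _))

lemma FODef.inBasic (i j k l m : ℕ) :
    FODef (fun w : ℕ → HSet θ => HSet.InBasic (w i) (w j) (w k) (w l) (w m)) :=
  (FODef.all ((FODef.mem _ _).imp (FODef.memValue _ _ _))).and
    (FODef.ex ((FODef.mem _ _).and (FODef.pair_mem _ _ _)))

lemma HSet.memValue_iff {v γ x : HSet θ} {f : Omega1 → ZFSet.{0}} (hv : v.1 = codeFun univ f)
    {γ' x' : Omega1} (hγ : γ.1 = codeOrd γ') (hx : x.1 = codeOrd x') :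
    HSet.MemValue v γ x ↔ x' ∈ {a : Omega1 | codeOrd a ∈ f γ'} := by
  unfold HSet.MemValue
  rw [hv, hγ, hx]
  constructor
  · rintro ⟨y, h1, h2⟩
    rw [pair_mem_codeFun] at h1
    rw [← h1.2] at h2
    exact h2
  · intro h
    have h1 : ZFSet.pair (codeOrd γ') (f γ') ∈ v.1 := by
      rw [hv, pair_mem_codeFun]
      exact ⟨mem_univ _, rfl⟩
    obtain ⟨_, y, _, hy⟩ := v.exists_of_pair_mem h1
    rw [← hv]
    exact ⟨y, hy ▸ h1, hy ▸ h⟩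

lemma HSet.forall_inBasic_iff {v g G W L : HSet θ} {f : Omega1 → ZFSet.{0}}
    (hv : v.1 = codeFun univ f) {ψ : Omega1 → Finset ℝ} (hg : IsFunctionSet g.1)
    (hψ : ∀ γ, ZFSet.pair (codeOrd γ) (codeRealFinset (ψ γ)) ∈ g.1)
    {G' L' : Finset Omega1} {W' : Set (Finset ℝ)} (hG : G.1 = codeFinset G')
    (hL : L.1 = codeFinset L') (hW : W.1 = codeRealFamily W') :
    (∀ x : HSet θ, x.1 ∈ L.1 → HSet.InBasic v g G W x) ↔
      (L' : Set Omega1) ⊆ basicNbhd (fun γ => {a | codeOrd a ∈ f γ}) ψ G' W' := by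
  constructor
  · intro h x hx
    have hxL : codeOrd x ∈ L.1 := by rw [hL, codeOrd_mem_codeFinset]; exact hx
    obtain ⟨h1, y, h2, h3⟩ := h (L.ofMem hxL) hxL
    refine ⟨fun γ hγ => ?_, ?_⟩
    · have hγG : codeOrd γ ∈ G.1 := by rw [hG, codeOrd_mem_codeFinset]; exact hγ
      exact (HSet.memValue_iff hv rfl rfl).1 (h1 (G.ofMem hγG) hγG)
    · have h4 : y.1 = codeRealFinset (ψ x) := hg.2 _ _ _ h3 (hψ x)
      rw [hW, h4, codeRealFinset_mem] at h2
      exact h2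
  · intro h x hx
    rw [hL, mem_codeFinset] at hx
    obtain ⟨x', hx', hxx⟩ := hx
    obtain ⟨h1, h2⟩ := h hx'
    refine ⟨fun γ hγ => ?_, ?_⟩
    · rw [hG, mem_codeFinset] at hγ
      obtain ⟨γ', hγ', hγγ⟩ := hγ
      exact (HSet.memValue_iff hv hγγ.symm hxx.symm).2 (h1 γ' hγ')
    · obtain ⟨_, y, _, hy⟩ := g.exists_of_pair_mem (hψ x')
      refine ⟨y, ?_, ?_⟩
      · rw [hW, hy, codeRealFinset_mem]; exact h2
      · rw [← hxx, hy]; exact hψ x'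

/-- A guessing model at `α` provides the combinatorial principle `Reflection`. The model knows the
uncountable set `z` that `B α` is the trace of, but a priori neither that the members of `z` are
finite sets of ordinals, nor that they are disjoint, nor that the function extending `φ_α` is
defined and injective on all of `ω₁`. All this holds for the elements of the model, hence holds
outright by elementarity. -/
theorem IsGuessingModel.exists_reflection (hB : IsFinsetDiamondSeq B)
    (hκ : 2 ^ (ℵ₁ : Cardinal.{0}) ≤ κ) (hθ : κ < θ) (hd : (B α).PairwiseDisjoint id)
    (hBα : B α ⊆ finsetsBelow α)
    (hφ : ∀ γ < α, (φ α γ).Nonempty)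
    (hφd : ∀ γ < α, ∀ δ < α, γ ≠ δ → Disjoint (φ α γ) (φ α δ))
    (hM : IsGuessingModel B U φ α θ M) :
    ∃ 𝓑 ψ V, Reflection B α (U α) (φ α) 𝓑 ψ V := by
  have hℵ : (ℵ₁ : Cardinal.{0}) ≤ 2 ^ (ℵ₁ : Cardinal.{0}) := (Cardinal.cantor _).le
  have h𝔠 : 𝔠 ≤ 2 ^ (ℵ₁ : Cardinal.{0}) := by
    rw [← Cardinal.two_power_aleph0]
    exact Cardinal.power_le_power_left two_ne_zero (Cardinal.aleph0_le_aleph 1)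
  have hθ' : 2 ^ (ℵ₁ : Cardinal.{0}) < θ := hκ.trans_lt hθ
  obtain ⟨-, ⟨S, rfl⟩, hord, hR, hb, ⟨g₀, hg₀, hgf, hgr⟩, ⟨z₀, hz₀, hzc, hzB⟩, Vz, hv, hVz⟩ := hM
  have hval : ∀ x ∈ Subtype.val '' (S : Set (HSet θ)), ∃ y : HSet θ, y ∈ S ∧ y.1 = x :=
    fun _ hx => hx
  obtain ⟨R, hR, hRc⟩ := hval _ hR
  obtain ⟨b, hbS, hb⟩ := hval _ hb
  obtain ⟨g, hgS, rfl⟩ := hval _ hg₀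
  obtain ⟨z, hzS, rfl⟩ := hval _ hz₀
  obtain ⟨v, hvS, hv⟩ := hval _ hv
  have hsub : IsSubmodelAt S α b := by
    refine ⟨hbS, ⟨_, hb⟩, fun x γ hx => ⟨fun hxS => ?_, fun hγ => ?_⟩⟩
    · have h1 : codeOrd γ ∈ codeOrd '' Iio α := by
        rw [← hord]
        exact ⟨⟨x, hxS, hx⟩, mem_range_self _⟩
      obtain ⟨δ, hδ, h2⟩ := h1
      exact codeOrd_injective h2 ▸ hδ
    · have h1 : codeOrd γ ∈ codeOrd '' Iio α := ⟨γ, hγ, rfl⟩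
      rw [← hord] at h1
      obtain ⟨⟨y, hy, hyx⟩, -⟩ := h1
      have : x = y := Subtype.ext (hx.trans hyx.symm)
      exact this ▸ hy
  -- members of `z` in `S` are the codes of the members of `B α`
  have hzmem : ∀ x ∈ S, x.1 ∈ z.1 → ∃ F ∈ B α, codeFinset F = x.1 := by
    intro x hxS hxz
    have : x.1 ∈ codeFinset '' B α := by
      rw [← hzB]
      exact ⟨⟨x, hxS, rfl⟩, hxz⟩
    exact this
  -- every finite set of countable ordinals is in the range of `B`, so that "`x` is a finite set of
  -- countable ordinals" can be expressed with the parameter `b`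
  have hzcode : ∀ x ∈ z.1, ∃ F, codeFinset F = x := by
    by_contra! hcon
    obtain ⟨x, hxz, hx⟩ := hcon
    have key := FODef.reflect (P := fun w : ℕ → HSet θ => (w 0).1 ∈ (w 1).1 ∧
        ¬ ∃ γ y : HSet θ, ZFSet.pair γ.1 y.1 ∈ (w 2).1 ∧ (w 0).1 ∈ y.1)
      (by apply_rules [FODef.ex, FODef.and, FODef.not, FODef.mem, FODef.pair_mem]) S [b] z
      (by simp [hbS, hzS])
      ⟨z.ofMem hxz, hxz, by
        rintro ⟨γ, y, h1, h2⟩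
        obtain ⟨δ, -, h3⟩ := mem_codeFun.1 (hb ▸ h1)
        change x ∈ y.1 at h2
        rw [← (ZFSet.pair_inj.1 h3).2] at h2
        obtain ⟨F, -, hF⟩ := mem_codeFamily.1 h2
        exact hx F hF⟩
    obtain ⟨x, hxS, hxz, hx⟩ := key
    obtain ⟨F, -, hF⟩ := hzmem x hxS hxz
    obtain ⟨β, hβ⟩ := hB.exists_mem F
    have h1 : ZFSet.pair (codeOrd β) (codeFamily (B β)) ∈ b.1 := by
      rw [hb, pair_mem_codeFun]
      exact ⟨mem_univ _, rfl⟩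
    obtain ⟨γ, y, hγ, hy⟩ := b.exists_of_pair_mem h1
    refine hx ⟨γ, y, ?_, ?_⟩
    · change ZFSet.pair γ.1 y.1 ∈ b.1
      rw [hγ, hy]; exact h1
    · change x.1 ∈ y.1
      rw [hy, ← hF, codeFinset_mem_codeFamily]
      exact hβ
  have hzdisj : ∀ x x' : HSet θ, x.1 ∈ z.1 → x'.1 ∈ z.1 → x ≠ x' →
      ∀ t : HSet θ, t.1 ∈ x.1 → ¬ t.1 ∈ x'.1 := by
    by_contra! hcon
    obtain ⟨x, hxS, x', hx, hx', hne, t, ht⟩ := FODef.reflect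
      (P := fun w : ℕ → HSet θ => ∃ x' : HSet θ, (w 0).1 ∈ (w 1).1 ∧ x'.1 ∈ (w 1).1 ∧
        ¬ w 0 = x' ∧ ∃ t : HSet θ, t.1 ∈ (w 0).1 ∧ t.1 ∈ x'.1)
      (by apply_rules [FODef.ex, FODef.and, FODef.not, FODef.eq, FODef.mem]) S [] z
      (by simp [hzS]) hcon
    obtain ⟨x', hxS', hx, hx', hne, t, ht, ht'⟩ := FODef.reflect
      (P := fun w : ℕ → HSet θ => (w 1).1 ∈ (w 2).1 ∧ (w 0).1 ∈ (w 2).1 ∧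
        ¬ w 1 = w 0 ∧ ∃ t : HSet θ, t.1 ∈ (w 1).1 ∧ t.1 ∈ (w 0).1)
      (by apply_rules [FODef.ex, FODef.and, FODef.not, FODef.eq, FODef.mem]) S [z] x
      (by simp [hzS, hxS]) ⟨x', hx, hx', hne, t, ht⟩
    obtain ⟨F, hF, hFx⟩ := hzmem x hxS hx
    obtain ⟨F', hF', hFx'⟩ := hzmem x' hxS' hx'
    change t.1 ∈ x.1 at ht
    change t.1 ∈ x'.1 at ht'
    rw [← hFx, mem_codeFinset] at ht
    obtain ⟨γ, hγ, hγt⟩ := ht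
    rw [← hFx', ← hγt, codeOrd_mem_codeFinset] at ht'
    have hFF : F ≠ F' := by
      rintro rfl
      exact hne (Subtype.ext (hFx.symm.trans hFx'))
    exact Finset.disjoint_left.1 (hd hF hF' hFF) hγ ht'
  have hgφ : ∀ γ < α, ZFSet.pair (codeOrd γ) (codeRealFinset (φ α γ)) ∈ g.1 := by
    intro γ hγ
    have h1 : ZFSet.pair (codeOrd γ) (codeRealFinset (φ α γ)) ∈ restrictFun g.1 (codeOrd α) := by
      rw [hgr, pair_mem_codeFun]
      exact ⟨hγ, rfl⟩
    exact (ZFSet.mem_sep.1 h1).1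
  -- the members of `R = 𝒲` serve to express that a value of `g` is a finite set of reals
  have hψ : ∀ γ, ∃ H : Finset ℝ, H.Nonempty ∧
      ZFSet.pair (codeOrd γ) (codeRealFinset H) ∈ g.1 := by
    by_contra! hcon
    obtain ⟨γ, hγ⟩ := hcon
    obtain ⟨x, hx⟩ := hsub.exists_ord γ
    obtain ⟨x, hxS, hxb, hx⟩ := FODef.reflect
      (P := fun w : ℕ → HSet θ => (∃ y : HSet θ, ZFSet.pair (w 0).1 y.1 ∈ (w 1).1) ∧
        ¬ ∃ y s : HSet θ, ZFSet.pair (w 0).1 y.1 ∈ (w 2).1 ∧ s.1 ∈ (w 3).1 ∧ y.1 ∈ s.1 ∧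
          ∃ t : HSet θ, t.1 ∈ y.1)
      (by apply_rules [FODef.ex, FODef.and, FODef.not, FODef.pair_mem, FODef.mem]) S [g, R] b
      (by simp [hgS, hR, hbS]) ⟨x, (hsub.dom_iff x).2 ⟨γ, hx⟩, by
        rintro ⟨y, s, h1, h2, h3, t, h4⟩
        change ZFSet.pair x.1 y.1 ∈ g.1 at h1
        change s.1 ∈ R.1 at h2
        rw [hRc] at h2
        obtain ⟨W, hW, hWs⟩ := mem_codeRatStars.1 h2
        rw [← hWs] at h3
        obtain ⟨H, hH, hHy⟩ := mem_codeSet.1 h3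
        rw [← hHy] at h4 h1
        obtain ⟨r, hr, -⟩ := mem_codeSet.1 h4
        exact hγ H ⟨r, hr⟩ (hx ▸ h1)⟩
    obtain ⟨γ, hγ⟩ := (hsub.dom_iff x).1 hxb
    have hγα : γ < α := (hsub.ord_mem_iff x γ hγ).1 hxS
    obtain ⟨W, hW, hφW, -⟩ := exists_ratStar (φ α γ) isOpen_univ (subset_univ _)
    obtain ⟨_, y, -, hy⟩ := g.exists_of_pair_mem (hgφ γ hγα)
    have hWR : codeRealFamily W ∈ R.1 := by
      rw [hRc]
      exact mem_codeRatStars.2 ⟨W, hW, rfl⟩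
    obtain ⟨r, hr⟩ := hφ γ hγα
    have hry : codeReal r ∈ y.1 := by
      rw [hy]
      exact mem_codeSet.2 ⟨r, hr, rfl⟩
    refine hx ⟨y, R.ofMem hWR, ?_, hWR, ?_, y.ofMem hry, hry⟩
    · change ZFSet.pair x.1 y.1 ∈ g.1
      rw [hγ, hy]; exact hgφ γ hγα
    · change y.1 ∈ codeRealFamily W
      rw [hy, codeRealFinset_mem]; exact hφW
  choose ψ hψn hψg using hψ
  have hψφ : ∀ γ < α, ψ γ = φ α γ := fun γ hγ =>
    codeRealFinset_injective (hgf.2 _ _ _ (hψg γ) (hgφ γ hγ))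
  have hψuniq : ∀ γ (x y : HSet θ), x.1 = codeOrd γ →
      (ZFSet.pair x.1 y.1 ∈ g.1 ↔ y.1 = codeRealFinset (ψ γ)) := by
    intro γ x y hx
    rw [hx]
    exact ⟨fun h => hgf.2 _ _ _ h (hψg γ), fun h => h ▸ hψg γ⟩
  have hψd : ∀ x y, x ≠ y → Disjoint (ψ x) (ψ y) := by
    have hP : ∀ x x' : HSet θ, (∃ y : HSet θ, ZFSet.pair x.1 y.1 ∈ b.1) →
        (∃ y : HSet θ, ZFSet.pair x'.1 y.1 ∈ b.1) → x ≠ x' →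
        ¬ ∃ y y' t : HSet θ, ZFSet.pair x.1 y.1 ∈ g.1 ∧ ZFSet.pair x'.1 y'.1 ∈ g.1 ∧
          t.1 ∈ y.1 ∧ t.1 ∈ y'.1 := by
      by_contra! hcon
      obtain ⟨x, hxS, x', hx, hx', hne, hy⟩ := FODef.reflect
        (P := fun w : ℕ → HSet θ => ∃ x' : HSet θ,
          (∃ y : HSet θ, ZFSet.pair (w 0).1 y.1 ∈ (w 1).1) ∧
          (∃ y : HSet θ, ZFSet.pair x'.1 y.1 ∈ (w 1).1) ∧ ¬ w 0 = x' ∧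
          ∃ y y' t : HSet θ, ZFSet.pair (w 0).1 y.1 ∈ (w 2).1 ∧
            ZFSet.pair x'.1 y'.1 ∈ (w 2).1 ∧ t.1 ∈ y.1 ∧ t.1 ∈ y'.1)
        (by apply_rules [FODef.ex, FODef.and, FODef.not, FODef.eq, FODef.mem, FODef.pair_mem])
        S [g] b (by simp [hgS, hbS]) hcon
      obtain ⟨x', hxS', hx, hx', hne, y, y', t, hy, hy', ht, ht'⟩ := FODef.reflect
        (P := fun w : ℕ → HSet θ =>
          (∃ y : HSet θ, ZFSet.pair (w 1).1 y.1 ∈ (w 2).1) ∧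
          (∃ y : HSet θ, ZFSet.pair (w 0).1 y.1 ∈ (w 2).1) ∧ ¬ w 1 = w 0 ∧
          ∃ y y' t : HSet θ, ZFSet.pair (w 1).1 y.1 ∈ (w 3).1 ∧
            ZFSet.pair (w 0).1 y'.1 ∈ (w 3).1 ∧ t.1 ∈ y.1 ∧ t.1 ∈ y'.1)
        (by apply_rules [FODef.ex, FODef.and, FODef.not, FODef.eq, FODef.mem, FODef.pair_mem])
        S [b, g] x (by simp [hgS, hbS, hxS]) ⟨x', hx, hx', hne, hy⟩
      change ZFSet.pair x.1 y.1 ∈ g.1 at hy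
      change ZFSet.pair x'.1 y'.1 ∈ g.1 at hy'
      obtain ⟨γ, hγ⟩ := (hsub.dom_iff x).1 hx
      obtain ⟨γ', hγ'⟩ := (hsub.dom_iff x').1 hx'
      have hγα := (hsub.ord_mem_iff x γ hγ).1 hxS
      have hγα' := (hsub.ord_mem_iff x' γ' hγ').1 hxS'
      rw [hψuniq γ x y hγ, hψφ γ hγα] at hy
      rw [hψuniq γ' x' y' hγ', hψφ γ' hγα'] at hy'
      rw [hy] at ht
      rw [hy'] at ht'
      obtain ⟨r, hr, hrt⟩ := mem_codeSet.1 ht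
      obtain ⟨r', hr', hrt'⟩ := mem_codeSet.1 ht'
      obtain rfl := codeReal_injective (hrt.trans hrt'.symm)
      have hne' : γ ≠ γ' := by
        rintro rfl
        exact hne (Subtype.ext (hγ.trans hγ'.symm))
      exact Finset.disjoint_left.1 (hφd γ hγα γ' hγα' hne') hr hr'
    intro γ γ' hne
    rw [Finset.disjoint_left]
    intro r hr hr'
    obtain ⟨x, y, hx, hy⟩ := g.exists_of_pair_mem (hψg γ)
    obtain ⟨x', y', hx', hy'⟩ := g.exists_of_pair_mem (hψg γ')
    have hry : codeReal r ∈ y.1 := by rw [hy]; exact mem_codeSet.2 ⟨r, hr, rfl⟩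
    refine hP x x' ((hsub.dom_iff x).2 ⟨γ, hx⟩) ((hsub.dom_iff x').2 ⟨γ', hx'⟩) ?_
      ⟨y, y', y.ofMem hry, (hψuniq γ x y hx).2 hy, (hψuniq γ' x' y' hx').2 hy', hry, ?_⟩
    · rintro rfl
      exact hne (codeOrd_injective (hx.symm.trans hx'))
    · change codeReal r ∈ y'.1
      rw [hy']; exact mem_codeSet.2 ⟨r, hr', rfl⟩
  have hVU : ∀ γ < α, ∀ x < α, codeOrd x ∈ Vz γ ↔ x ∈ U α γ := by
    intro γ hγ x hx
    have h1 : codeOrd x ∈ Vz γ ∩ codeOrd α ↔ x ∈ U α γ ∩ Iio α := by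
      rw [hVz γ hγ, code_mem_codeSet codeOrd_injective]
    rw [ZFSet.mem_inter, codeOrd_mem_codeOrd] at h1
    simpa [hx] using h1
  -- below `α` the basic neighbourhoods in the sense of the model are the given ones
  have hbasic : ∀ G : Finset Omega1, (∀ γ ∈ G, γ < α) → ∀ W, ∀ L : Finset Omega1,
      (∀ x ∈ L, x < α) → ((L : Set Omega1) ⊆ basicNbhd (fun γ => {a | codeOrd a ∈ Vz γ}) ψ G W ↔
        (L : Set Omega1) ⊆ basicNbhd (U α) (φ α) G W) := by
    intro G hG W L hL
    refine forall₂_congr fun x hx => ?_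
    refine and_congr (forall₂_congr fun γ hγ => hVU γ (hG γ hγ) x (hL x hx)) ?_
    rw [hψφ x (hL x hx)]
  -- `𝒲` is countable, so that all its members belong to the model
  have hWS : ∀ W ∈ ratStars, ∃ w ∈ S, w.1 = codeRealFamily W := by
    intro W hW
    have hWR : codeRealFamily W ∈ R.1 := by
      rw [hRc]
      exact mem_codeRatStars.2 ⟨W, hW, rfl⟩
    refine ⟨R.ofMem hWR, hsub.mem_of_mem_countable hℵ hθ' hR ?_ ?_ hWR, rfl⟩
    · rw [hRc]; exact HCardLE.codeRatStars h𝔠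
    · refine (ratStars_countable.image codeRealFamily).mono ?_
      intro x hx
      rw [hRc] at hx
      exact mem_codeRatStars.1 hx
  refine ⟨{F | codeFinset F ∈ z.1}, ψ, fun γ => {a | codeOrd a ∈ Vz γ}, ?_, ?_, hψn, hψd, ?_, ?_⟩
  · intro hc
    refine hzc ((hc.image codeFinset).mono ?_)
    intro x hx
    obtain ⟨F, rfl⟩ := hzcode x hx
    exact ⟨F, hx, rfl⟩
  · intro F hF F' hF' hne
    replace hF : codeFinset F ∈ z.1 := hF
    replace hF' : codeFinset F' ∈ z.1 := hF'
    change Disjoint F F'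
    rw [Finset.disjoint_left]
    intro γ hγ hγ'
    have h1 : codeOrd γ ∈ codeFinset F := codeOrd_mem_codeFinset.2 hγ
    refine hzdisj (z.ofMem hF) (z.ofMem hF') hF hF' (fun h => ?_)
      ((z.ofMem hF).ofMem h1) h1 (codeOrd_mem_codeFinset.2 hγ')
    exact hne (codeFinset_injective (congrArg Subtype.val h))
  · intro G hG W hW L hL hLN
    replace hL : codeFinset L ∈ z.1 := hL
    obtain ⟨G₁, hG₁S, hG₁⟩ := hsub.codeFinset_mem (hℵ.trans_lt hθ') G hG
    obtain ⟨W₁, hW₁S, hW₁⟩ := hWS W hW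
    obtain ⟨l, hlS, hlz, hl⟩ := FODef.reflect
      (P := fun w : ℕ → HSet θ => (w 0).1 ∈ (w 1).1 ∧
        ∀ x : HSet θ, x.1 ∈ (w 0).1 → HSet.InBasic (w 2) (w 3) (w 4) (w 5) x)
      (by apply_rules [FODef.inBasic, FODef.mem, FODef.and, FODef.all, FODef.imp])
      S [v, g, G₁, W₁] z (by simp [hvS, hgS, hG₁S, hW₁S, hzS])
      ⟨z.ofMem hL, hL, (HSet.forall_inBasic_iff hv hgf hψg hG₁ rfl hW₁).2 hLN⟩
    obtain ⟨F, hF, hFl⟩ := hzmem l hlS hlz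
    refine ⟨F, hF, ?_⟩
    rw [← hbasic G hG W F fun x hx => hBα hF x hx]
    exact (HSet.forall_inBasic_iff hv hgf hψg hG₁ hFl.symm hW₁).1 hl
  · intro β hβ hBβ G hG W hW K hK L hL hLβ hLF
    replace hL : codeFinset L ∈ z.1 := hL
    obtain ⟨G₁, hG₁S, hG₁⟩ := hsub.codeFinset_mem (hℵ.trans_lt hθ') G hG
    obtain ⟨K₁, hK₁S, hK₁⟩ := hsub.codeFinset_mem (hℵ.trans_lt hθ') K hK
    obtain ⟨W₁, hW₁S, hW₁⟩ := hWS W hW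
    obtain ⟨b₁, hb₁S, hb₁⟩ := hsub.exists_ord_mem hβ
    obtain ⟨D, hDS, hD⟩ : ∃ D ∈ S, D.1 = codeFamily (B β) := by
      have h1 : ZFSet.pair (codeOrd β) (codeFamily (B β)) ∈ b.1 := by
        rw [hb, pair_mem_codeFun]
        exact ⟨mem_univ _, rfl⟩
      obtain ⟨_, D, _, hD⟩ := b.exists_of_pair_mem h1
      obtain ⟨D, hDS, hD'⟩ := FODef.reflect
        (P := fun w : ℕ → HSet θ => ZFSet.pair (w 2).1 (w 0).1 ∈ (w 1).1)
        (FODef.pair_mem _ _ _) S [b₁] b (by simp [hbS, hb₁S])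
        ⟨D, by change ZFSet.pair b₁.1 D.1 ∈ b.1; rw [hD, hb₁]; exact h1⟩
      change ZFSet.pair b₁.1 D.1 ∈ b.1 at hD'
      rw [hb, hb₁, pair_mem_codeFun] at hD'
      exact ⟨D, hDS, hD'.2.symm⟩
    -- the property of `L` that is to be reflected
    let Q : HSet θ → HSet θ → HSet θ → HSet θ → HSet θ → HSet θ → HSet θ → HSet θ → Prop :=
      fun l b₁ D v g G₁ W₁ K₁ => (∀ x : HSet θ, x.1 ∈ l.1 → b₁.1 ∈ x.1) ∧
        ∀ F : HSet θ, F.1 ∈ D.1 → (∀ x : HSet θ, x.1 ∈ F.1 → HSet.InBasic v g G₁ W₁ x) →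
          (∀ γ : HSet θ, γ.1 ∈ F.1 → ∀ x : HSet θ, x.1 ∈ K₁.1 → HSet.MemValue v γ x) →
          ∃ γ : HSet θ, γ.1 ∈ F.1 ∧ ∃ x : HSet θ, x.1 ∈ l.1 ∧ ¬ HSet.MemValue v γ x
    have hQ : ∀ (l : HSet θ) (L : Finset Omega1), l.1 = codeFinset L →
        (Q l b₁ D v g G₁ W₁ K₁ ↔ (∀ x ∈ L, β < x) ∧
          ∀ F ∈ B β, (F : Set Omega1) ⊆ basicNbhd (U α) (φ α) G W →
            (∀ γ ∈ F, (K : Set Omega1) ⊆ U α γ) → ∃ γ ∈ F, ∃ x ∈ L, ¬ codeOrd x ∈ Vz γ) := by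
      intro l L hlL
      refine and_congr ⟨fun h x hx => ?_, fun h x hx => ?_⟩
        ⟨fun h F hF hFN hFK => ?_, fun h F hF hFN hFK => ?_⟩
      · have hxl : codeOrd x ∈ l.1 := by rw [hlL, codeOrd_mem_codeFinset]; exact hx
        rw [← codeOrd_mem_codeOrd, ← hb₁]
        exact h (l.ofMem hxl) hxl
      · rw [hlL, mem_codeFinset] at hx
        obtain ⟨x', hx', hxx⟩ := hx
        rw [← hxx, hb₁, codeOrd_mem_codeOrd]
        exact h x' hx'
      · have hFD : codeFinset F ∈ D.1 := by rw [hD, codeFinset_mem_codeFamily]; exact hF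
        obtain ⟨γ, hγ, x, hx, hγx⟩ := h (D.ofMem hFD) hFD
          ((HSet.forall_inBasic_iff hv hgf hψg hG₁ rfl hW₁).2
            ((hbasic G hG W F fun x hx => (hBβ hF x hx).trans hβ).2 hFN)) (by
            intro γ hγ x hx
            obtain ⟨γ', hγ', hγγ⟩ := mem_codeFinset.1 hγ
            rw [hK₁, mem_codeFinset] at hx
            obtain ⟨x', hx', hxx⟩ := hx
            refine (HSet.memValue_iff hv hγγ.symm hxx.symm).2 ?_
            exact (hVU γ' ((hBβ hF γ' hγ').trans hβ) x' (hK x' hx')).2 (hFK γ' hγ' hx'))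
        obtain ⟨γ', hγ', hγγ⟩ := mem_codeFinset.1 hγ
        rw [hlL, mem_codeFinset] at hx
        obtain ⟨x', hx', hxx⟩ := hx
        exact ⟨γ', hγ', x', hx', fun h' =>
          hγx ((HSet.memValue_iff hv hγγ.symm hxx.symm).2 h')⟩
      · rw [hD, mem_codeFamily] at hF
        obtain ⟨F', hF', hFF⟩ := hF
        obtain ⟨γ, hγ, x, hx, hγx⟩ := h F' hF'
          ((hbasic G hG W F' fun x hx => (hBβ hF' x hx).trans hβ).1
            ((HSet.forall_inBasic_iff hv hgf hψg hG₁ hFF.symm hW₁).1 hFN)) (by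
            intro γ hγ x hx
            have hγF : codeOrd γ ∈ F.1 := by rw [← hFF, codeOrd_mem_codeFinset]; exact hγ
            have hxK : codeOrd x ∈ K₁.1 := by rw [hK₁, codeOrd_mem_codeFinset]; exact hx
            refine (hVU γ ((hBβ hF' γ hγ).trans hβ) x (hK x hx)).1 ?_
            exact (HSet.memValue_iff hv rfl rfl).1 (hFK (F.ofMem hγF) hγF (K₁.ofMem hxK) hxK))
        have hγF : codeOrd γ ∈ F.1 := by rw [← hFF, codeOrd_mem_codeFinset]; exact hγ
        have hxl : codeOrd x ∈ l.1 := by rw [hlL, codeOrd_mem_codeFinset]; exact hx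
        exact ⟨F.ofMem hγF, hγF, l.ofMem hxl, hxl, fun h' =>
          hγx ((HSet.memValue_iff hv rfl rfl).1 h')⟩
    obtain ⟨l, hlS, hlz, hl⟩ := FODef.reflect
      (P := fun w : ℕ → HSet θ => (w 0).1 ∈ (w 1).1 ∧
        Q (w 0) (w 2) (w 3) (w 4) (w 5) (w 6) (w 7) (w 8))
      (by apply_rules [FODef.inBasic, FODef.memValue, FODef.mem, FODef.not, FODef.and, FODef.all,
        FODef.ex, FODef.imp])
      S [b₁, D, v, g, G₁, W₁, K₁] z (by simp [hvS, hgS, hG₁S, hW₁S, hzS, hb₁S, hDS, hK₁S])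
      ⟨z.ofMem hL, hL, (hQ _ L rfl).2 ⟨hLβ, hLF⟩⟩
    obtain ⟨L', hL', hLl⟩ := hzmem l hlS hlz
    obtain ⟨h1, h2⟩ := (hQ l L' hLl.symm).1 hl
    refine ⟨L', hL', h1, fun F hF hFN hFK => ?_⟩
    obtain ⟨γ, hγ, x, hx, hxγ⟩ := h2 F hF hFN hFK
    exact ⟨γ, hγ, x, hx, fun h =>
      hxγ ((hVU γ ((hBβ hF γ hγ).trans hβ) x (hBα hL' x hx)).2 h)⟩

end

/-! ### The fusion argument -/

lemma countable_finsetsBelow (β : Omega1) : (finsetsBelow β).Countable := by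
  have := Set.countable_ofPred_finite_subset (countable_Iio_omega1 β)
  refine (this.preimage (f := fun s : Finset Omega1 => (s : Set Omega1))
    Finset.coe_injective).mono ?_
  intro s hs
  exact ⟨s.finite_toSet, hs⟩

/-- Only countably many members of a disjoint family meet a given countable set. -/
lemma countable_meeting {𝓑 : Set (Finset Omega1)} (h𝓑 : 𝓑.PairwiseDisjoint id) {Y : Set Omega1}
    (hY : Y.Countable) : {L ∈ 𝓑 | ∃ x ∈ L, x ∈ Y}.Countable := by
  have h : {L ∈ 𝓑 | ∃ x ∈ L, x ∈ Y} ⊆ ⋃ x ∈ Y, {L ∈ 𝓑 | x ∈ L} := by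
    rintro L ⟨hL, x, hx, hxY⟩
    exact mem_biUnion hxY ⟨hL, hx⟩
  refine (hY.biUnion fun x _ => Set.Subsingleton.countable ?_).mono h
  rintro L ⟨hL, hx⟩ L' ⟨hL', hx'⟩
  by_contra hne
  exact Finset.disjoint_left.1 (h𝓑 hL hL' hne) hx hx'

lemma exists_not_countable_of_cover {X ι : Type*} {s : Set X} (hs : ¬ s.Countable) {I : Set ι}
    (hI : I.Countable) {f : ι → Set X} (h : s ⊆ ⋃ i ∈ I, f i) :
    ∃ i ∈ I, ¬ (s ∩ f i).Countable := by
  by_contra! hcon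
  refine hs ((hI.biUnion hcon).mono fun x hx => ?_)
  obtain ⟨i, hi, hxi⟩ := mem_iUnion₂.1 (h hx)
  exact mem_biUnion hi ⟨hx, hxi⟩

/-- An uncountable family of points of a separable metric space accumulates in some small closed
set that avoids a given closed set containing only countably many of the points. -/
lemma exists_small_closed {ι X : Type*} [MetricSpace X] [SecondCountableTopology X] {s : Set ι}
    (hs : ¬ s.Countable) (r : ι → X) {Z : Set X} (hZ : IsClosed Z)
    (hsZ : {i ∈ s | r i ∈ Z}.Countable) {ε : ℝ} (hε : 0 < ε) :
    ∃ s' ⊆ s, ¬ s'.Countable ∧ ∃ E : Set X, IsClosed E ∧ Disjoint E Z ∧ (∀ i ∈ s', r i ∈ E) ∧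
      ∀ x ∈ E, ∀ y ∈ E, dist x y ≤ ε := by
  have h1 : ∀ p ∈ Zᶜ, ∃ δ, 0 < δ ∧ δ ≤ ε / 2 ∧ Metric.closedBall p δ ⊆ Zᶜ := by
    intro p hp
    obtain ⟨δ, hδ, hb⟩ := Metric.isOpen_iff.1 hZ.isOpen_compl p hp
    refine ⟨min (δ / 2) (ε / 2), by positivity, min_le_right _ _, ?_⟩
    exact (Metric.closedBall_subset_ball
      ((min_le_left _ _).trans_lt (half_lt_self hδ))).trans hb
  choose! δ hδ hδε hδZ using h1
  obtain ⟨t, htZ, ht, hcov⟩ := TopologicalSpace.countable_cover_nhdsWithin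
    (s := Zᶜ) (f := fun p => Metric.closedBall p (δ p))
    fun p hp => nhdsWithin_le_nhds (Metric.closedBall_mem_nhds p (hδ p hp))
  have hs' : ¬ (s \ {i ∈ s | r i ∈ Z}).Countable := fun h =>
    hs ((h.union hsZ).mono fun i hi => by by_cases h : r i ∈ Z <;> simp [hi, h])
  obtain ⟨p, hp, hpc⟩ := exists_not_countable_of_cover hs' ht
    (f := fun p => r ⁻¹' Metric.closedBall p (δ p)) (by
      rintro i ⟨hi, hiZ⟩
      obtain ⟨p, hp, hip⟩ := mem_iUnion₂.1 (hcov (show r i ∈ Zᶜ from fun h => hiZ ⟨hi, h⟩))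
      exact mem_biUnion hp hip)
  refine ⟨_, inter_subset_left.trans sdiff_subset, hpc, Metric.closedBall p (δ p),
    Metric.isClosed_closedBall, disjoint_left.2 fun x hx => hδZ p (htZ hp) hx,
    fun i hi => hi.2, fun x hx y hy => ?_⟩
  have h2 := dist_triangle_right x y p
  have h3 := hδε p (htZ hp)
  rw [Metric.mem_closedBall] at hx hy
  linarith

/-- The core of a successor step. Countably many tasks `t` are given; each has to be fulfilled by
some `F ∈ B (β t)`, and for every finite `G` contained in the union of the selected sets and every basic condition
on the finite set `b` to be constructed there must be some `L ∈ B α` inside the resulting basic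
open set. The sets `S t` are selected one after another together with a decreasing sequence of
uncountable subfamilies `𝓛 n` of `𝓑`, all of whose members lie in `V γ` for the `γ` selected so
far. At the same time the finite sets `⋃ ψ[L]` for `L ∈ 𝓛 n`, enumerated as points of `ℝᵏ`, are
confined to smaller and smaller closed sets off `Z n`, and `b` is the set of coordinates of the
limit. A basic condition on `b` then holds for `⋃ ψ[L]` for all `L` far enough in the sequence, and
`reflect_nbhd` moves such an `L` from `𝓑` to `B α`. -/
theorem Reflection.exists_selection {B : Omega1 → Set (Finset Omega1)} {α : Omega1}
    {u : Omega1 → Set Omega1} {h : Omega1 → Finset ℝ} {𝓑 : Set (Finset Omega1)}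
    {ψ : Omega1 → Finset ℝ} {V : Omega1 → Set Omega1} (R : Reflection B α u h 𝓑 ψ V)
    {T : Type*} [Countable T] {β : T → Omega1} {G K : T → Finset Omega1}
    {W : T → Set (Finset ℝ)} (hβ : ∀ t, β t < α) (hBβ : ∀ t, B (β t) ⊆ finsetsBelow (β t))
    (hG : ∀ t, ∀ γ ∈ G t, γ < α) (hW : ∀ t, W t ∈ ratStars) (hK : ∀ t, ∀ γ ∈ K t, γ < α)
    (hcov : ∀ t, ∀ L ∈ B α, (∀ x ∈ L, β t < x) → ∃ F ∈ B (β t),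
      (F : Set Omega1) ⊆ basicNbhd u h (G t) (W t) ∧ (∀ γ ∈ F, (K t : Set Omega1) ⊆ u γ) ∧
        ∀ γ ∈ F, (L : Set Omega1) ⊆ u γ)
    (Z : ℕ → Finset ℝ) :
    ∃ S : T → Finset Omega1, (∀ t, S t ∈ B (β t) ∧
        (S t : Set Omega1) ⊆ basicNbhd u h (G t) (W t) ∧ ∀ γ ∈ S t, (K t : Set Omega1) ⊆ u γ) ∧
      ∃ b : Finset ℝ, b.Nonempty ∧ (∀ n, Disjoint b (Z n)) ∧
        ∀ G : Finset Omega1, (∀ γ ∈ G, ∃ t, γ ∈ S t) → ∀ W ∈ ratStars, b ∈ W →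
          ∃ L ∈ B α, (L : Set Omega1) ⊆ basicNbhd u h G W := by
  obtain ⟨e, he⟩ := exists_injective_nat T
  -- an uncountable subfamily for which the sets `⋃ ψ[L]` are nonempty and of constant size `k`
  have h0 : ¬ (𝓑 \ {∅}).Countable := fun hc =>
    R.not_countable ((hc.union (countable_singleton ∅)).mono fun L hL => by
      by_cases h : L = ∅ <;> simp [hL, h])
  obtain ⟨k, -, hk⟩ := exists_not_countable_of_cover h0 (countable_univ (α := ℕ))
    (f := fun k => {L | (L.biUnion ψ).card = k}) fun L _ => by simp
  set 𝓛₀ := (𝓑 \ {∅}) ∩ {L | (L.biUnion ψ).card = k} with h𝓛₀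
  have h𝓛₀𝓑 : 𝓛₀ ⊆ 𝓑 := inter_subset_left.trans sdiff_subset
  have hkpos : 0 < k := by
    obtain ⟨L, ⟨hL, hLne⟩, hLk⟩ : 𝓛₀.Nonempty := by
      by_contra hcon
      rw [not_nonempty_iff_eq_empty] at hcon
      exact hk (hcon ▸ countable_empty)
    obtain ⟨x, hx⟩ := Finset.nonempty_iff_ne_empty.2 hLne
    obtain ⟨y, hy⟩ := R.nonempty x
    rw [← (show (L.biUnion ψ).card = k from hLk)]
    exact Finset.card_pos.2 ⟨y, Finset.mem_biUnion.2 ⟨x, hx, hy⟩⟩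
  have hr : ∀ L : Finset Omega1, ∃ r : Fin k → ℝ, L ∈ 𝓛₀ → range r = L.biUnion ψ := by
    intro L
    by_cases hL : L ∈ 𝓛₀
    · have hc : (L.biUnion ψ).card = k := hL.2
      exact ⟨fun i => ((L.biUnion ψ).equivFinOfCardEq hc).symm i, fun _ => by
        ext x
        constructor
        · rintro ⟨i, rfl⟩
          exact (((L.biUnion ψ).equivFinOfCardEq hc).symm i).2
        · intro hx
          exact ⟨(L.biUnion ψ).equivFinOfCardEq hc ⟨x, hx⟩, by simp⟩⟩
    · exact ⟨fun _ => 0, fun h => absurd h hL⟩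
  choose r hr using hr
  -- one stage of the fusion: the task with number `n` is fulfilled, and the limit is kept off `Z n`
  have hstep : ∀ (n : ℕ) (𝓛 : Set (Finset Omega1)), 𝓛 ⊆ 𝓛₀ → ¬ 𝓛.Countable →
      ∃ 𝓛' ⊆ 𝓛, ¬ 𝓛'.Countable ∧
        (∀ t, e t = n → ∃ F ∈ B (β t), (F : Set Omega1) ⊆ basicNbhd u h (G t) (W t) ∧
          (∀ γ ∈ F, (K t : Set Omega1) ⊆ u γ) ∧ ∀ L ∈ 𝓛', ∀ γ ∈ F, (L : Set Omega1) ⊆ V γ) ∧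
        ∃ E : Set (Fin k → ℝ), IsClosed E ∧ Disjoint E {x | ∃ i, x i ∈ Z n} ∧
          (∀ L ∈ 𝓛', r L ∈ E) ∧ ∀ x ∈ E, ∀ y ∈ E, dist x y ≤ 1 / ((n : ℝ) + 1) := by
    intro n 𝓛 h𝓛 h𝓛c
    -- by reflection, uncountably many `L ∈ 𝓛` are covered by one and the same `F`
    obtain ⟨𝓛₁, h𝓛₁, h𝓛₁c, hF⟩ : ∃ 𝓛₁ ⊆ 𝓛, ¬ 𝓛₁.Countable ∧
        ∀ t, e t = n → ∃ F ∈ B (β t), (F : Set Omega1) ⊆ basicNbhd u h (G t) (W t) ∧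
          (∀ γ ∈ F, (K t : Set Omega1) ⊆ u γ) ∧ ∀ L ∈ 𝓛₁, ∀ γ ∈ F, (L : Set Omega1) ⊆ V γ := by
      by_cases hn : ∃ t, e t = n
      swap
      · exact ⟨𝓛, Subset.rfl, h𝓛c, fun t ht => absurd ⟨t, ht⟩ hn⟩
      obtain ⟨t, rfl⟩ := hn
      have hm := countable_meeting R.pairwiseDisjoint (countable_Iic_omega1 (β t))
      have hc : ¬ (𝓛 \ {L ∈ 𝓑 | ∃ x ∈ L, x ∈ Iic (β t)}).Countable := fun hc =>
        h𝓛c ((hc.union hm).mono fun L hL => by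
          by_cases h : L ∈ {L ∈ 𝓑 | ∃ x ∈ L, x ∈ Iic (β t)}
          · exact Or.inr h
          · exact Or.inl ⟨hL, h⟩)
      obtain ⟨F, ⟨hFB, hFN, hFK⟩, hFc⟩ := exists_not_countable_of_cover hc
        (I := {F ∈ B (β t) | (F : Set Omega1) ⊆ basicNbhd u h (G t) (W t) ∧
          ∀ γ ∈ F, (K t : Set Omega1) ⊆ u γ})
        (f := fun F => {L | ∀ γ ∈ F, (L : Set Omega1) ⊆ V γ})
        ((countable_finsetsBelow (β t)).mono fun F hF => hBβ t hF.1) (by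
          rintro L ⟨hL, hLβ⟩
          by_contra hcon
          simp only [mem_iUnion, not_exists] at hcon
          have hL𝓑 : L ∈ 𝓑 := h𝓛₀𝓑 (h𝓛 hL)
          obtain ⟨L', hL', hL'β, hL'F⟩ := R.reflect_cover (β t) (hβ t) (hBβ t) (G t) (hG t) (W t)
            (hW t) (K t) (hK t) L hL𝓑
            (fun x hx => not_le.1 fun hxβ => hLβ ⟨hL𝓑, x, hx, hxβ⟩)
            (fun F hF hFN hFK => by
              have := hcon F ⟨hF, hFN, hFK⟩
              simp only [mem_ofPred_eq, not_forall, Set.not_subset] at this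
              obtain ⟨γ, hγ, x, hx, hxγ⟩ := this
              exact ⟨γ, hγ, x, hx, hxγ⟩)
          obtain ⟨F, hF, hFN, hFK, hFL⟩ := hcov t L' hL' hL'β
          obtain ⟨γ, hγ, x, hx, hxγ⟩ := hL'F F hF hFN hFK
          exact hxγ (hFL γ hγ hx))
      refine ⟨_, inter_subset_left.trans sdiff_subset, hFc, fun t' ht' => ?_⟩
      obtain rfl := he ht'
      exact ⟨F, hFB, hFN, hFK, fun L hL => hL.2⟩
    have hZc : IsClosed {x : Fin k → ℝ | ∃ i, x i ∈ Z n} := by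
      have : {x : Fin k → ℝ | ∃ i, x i ∈ Z n} = ⋃ i, (fun x : Fin k → ℝ => x i) ⁻¹' (Z n) := by
        ext; simp
      rw [this]
      exact isClosed_iUnion_of_finite fun i =>
        (Z n).finite_toSet.isClosed.preimage (continuous_apply i)
    -- each point of `Z n` belongs to `ψ x` for at most one `x`
    have hZL : {L ∈ 𝓛₁ | r L ∈ {x : Fin k → ℝ | ∃ i, x i ∈ Z n}}.Countable := by
      have hY : {x : Omega1 | ∃ p ∈ Z n, p ∈ ψ x}.Countable := by
        have hsub : {x : Omega1 | ∃ p ∈ Z n, p ∈ ψ x} ⊆ ⋃ p ∈ (Z n : Set ℝ), {x | p ∈ ψ x} := by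
          rintro x ⟨p, hp, hx⟩
          exact mem_biUnion (show p ∈ (Z n : Set ℝ) from hp) hx
        refine ((Z n).countable_toSet.biUnion fun p _ => Set.Subsingleton.countable ?_).mono hsub
        intro x hx y hy
        by_contra hne
        exact Finset.disjoint_left.1 (R.disjoint x y hne) hx hy
      refine (countable_meeting R.pairwiseDisjoint hY).mono ?_
      rintro L ⟨hL, i, hi⟩
      have hmem : r L i ∈ ((L.biUnion ψ : Finset ℝ) : Set ℝ) := by
        rw [← hr L (h𝓛 (h𝓛₁ hL))]; exact mem_range_self i
      obtain ⟨x, hx, hxr⟩ := Finset.mem_biUnion.1 hmem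
      exact ⟨h𝓛₀𝓑 (h𝓛 (h𝓛₁ hL)), x, hx, r L i, hi, hxr⟩
    obtain ⟨𝓛', h𝓛', h𝓛'c, E, hE⟩ := exists_small_closed h𝓛₁c r hZc hZL
      (show (0 : ℝ) < 1 / ((n : ℝ) + 1) by positivity)
    refine ⟨𝓛', h𝓛'.trans h𝓛₁, h𝓛'c, fun t ht => ?_, E, hE⟩
    obtain ⟨F, h1, h2, h3, h4⟩ := hF t ht
    exact ⟨F, h1, h2, h3, fun L hL => h4 L (h𝓛' hL)⟩
  choose! next hnext_sub hnext_c hnextF hnextE using hstep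
  let 𝓛 : ℕ → Set (Finset Omega1) := fun n => Nat.rec 𝓛₀ (fun n s => next n s) n
  have h𝓛 : ∀ n, 𝓛 n ⊆ 𝓛₀ ∧ ¬ (𝓛 n).Countable := by
    intro n
    induction n with
    | zero => exact ⟨Subset.rfl, hk⟩
    | succ n ih => exact ⟨(hnext_sub n _ ih.1 ih.2).trans ih.1, hnext_c n _ ih.1 ih.2⟩
  have hanti : Antitone 𝓛 := antitone_nat_of_succ_le fun n => hnext_sub n _ (h𝓛 n).1 (h𝓛 n).2
  have hne : ∀ n, ∃ L, L ∈ 𝓛 n := by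
    intro n
    by_contra! hcon
    exact (h𝓛 n).2 ((eq_empty_of_forall_notMem hcon) ▸ countable_empty)
  have hSex : ∀ t, ∃ F ∈ B (β t), (F : Set Omega1) ⊆ basicNbhd u h (G t) (W t) ∧
      (∀ γ ∈ F, (K t : Set Omega1) ⊆ u γ) ∧
      ∀ L ∈ 𝓛 (e t + 1), ∀ γ ∈ F, (L : Set Omega1) ⊆ V γ :=
    fun t => hnextF (e t) _ (h𝓛 _).1 (h𝓛 _).2 t rfl
  choose S hSB hSN hSK hSV using hSex
  have hE : ∀ n, ∃ E : Set (Fin k → ℝ), IsClosed E ∧ Disjoint E {x | ∃ i, x i ∈ Z n} ∧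
      (∀ L ∈ 𝓛 (n + 1), r L ∈ E) ∧ ∀ x ∈ E, ∀ y ∈ E, dist x y ≤ 1 / ((n : ℝ) + 1) :=
    fun n => hnextE n _ (h𝓛 _).1 (h𝓛 _).2
  choose E hEc hEZ hEr hEd using hE
  choose L hL using hne
  -- the points `r (L n)` converge, because the sets `E n` shrink
  have hmemE : ∀ n m, n < m → r (L m) ∈ E n := fun n m hnm => hEr n _ (hanti hnm (hL m))
  have hcauchy : CauchySeq fun n => r (L n) := by
    rw [Metric.cauchySeq_iff']
    intro ε hε
    obtain ⟨n, hn⟩ := exists_nat_one_div_lt hε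
    exact ⟨n + 1, fun m hm =>
      (hEd n _ (hmemE n m hm) _ (hmemE n (n + 1) n.lt_succ_self)).trans_lt hn⟩
  obtain ⟨x, hx⟩ := cauchySeq_tendsto_of_complete hcauchy
  have hxE : ∀ n, x ∈ E n := fun n => (hEc n).mem_of_tendsto hx
    (Filter.eventually_atTop.2 ⟨n + 1, fun m hm => hmemE n m hm⟩)
  refine ⟨S, fun t => ⟨hSB t, hSN t, hSK t⟩, Finset.univ.image x, ?_, ?_, ?_⟩
  · exact ⟨x ⟨0, hkpos⟩, Finset.mem_image_of_mem _ (Finset.mem_univ _)⟩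
  · intro n
    rw [Finset.disjoint_left]
    intro p hp hpZ
    obtain ⟨i, -, rfl⟩ := Finset.mem_image.1 hp
    exact disjoint_left.1 (hEZ n) (hxE n) ⟨i, hpZ⟩
  · intro G' hG' W' hW' hb
    have hG'' : ∀ γ ∈ G', ∃ N t, γ ∈ S t ∧ e t + 1 = N := fun γ hγ => by
      obtain ⟨t, ht⟩ := hG' γ hγ
      exact ⟨_, t, ht, rfl⟩
    choose! N hN using hG''
    have hO : ∃ O : Set ℝ, IsOpen O ∧ W' = starSet O := by
      obtain ⟨I, -, -, rfl⟩ := hW'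
      exact ⟨_, isOpen_biUnion fun _ _ => isOpen_Ioo, rfl⟩
    obtain ⟨O, hO, rfl⟩ := hO
    have hopen : IsOpen {y : Fin k → ℝ | ∀ i, y i ∈ O} := by
      simp only [ofPred_forall]
      exact isOpen_iInter_of_finite fun i => hO.preimage (continuous_apply i)
    have hxO : x ∈ {y : Fin k → ℝ | ∀ i, y i ∈ O} := fun i =>
      hb (by simp)
    obtain ⟨ε, hε, hball⟩ := Metric.isOpen_iff.1 hopen x hxO
    obtain ⟨n, hn⟩ := exists_nat_one_div_lt hε
    let m := max (n + 1) (G'.sup N)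
    have hLm : L m ∈ 𝓛₀ := (h𝓛 m).1 (hL m)
    refine R.reflect_nbhd G' (fun γ hγ => ?_) _ hW' (L m) (h𝓛₀𝓑 hLm)
      fun y hy => ⟨fun γ hγ => ?_, ?_⟩
    · obtain ⟨t, ht, -⟩ := hN γ hγ
      exact (hBβ _ (hSB t) γ ht).trans (hβ _)
    · obtain ⟨t, ht, htN⟩ := hN γ hγ
      have hm : e t + 1 ≤ m := (htN.le.trans (Finset.le_sup hγ)).trans (le_max_right _ _)
      exact hSV t (L m) (hanti hm (hL m)) γ ht hy
    · intro p hp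
      have hpr : p ∈ range (r (L m)) := by
        rw [hr _ hLm]
        exact Finset.mem_coe.2 (Finset.mem_biUnion.2 ⟨y, hy, hp⟩)
      obtain ⟨i, rfl⟩ := hpr
      refine hball ?_ i
      exact (hEd n _ (hmemE n m (Nat.lt_of_succ_le (le_max_left _ _))) _ (hxE n)).trans_lt hn

/-! ### The transfinite construction -/

/-- A construction is determined by a function `D` on `ω₁`: the first component of `D x` is the
set of those `γ < x` with `x ∈ U_γ` (only its intersection with `x` matters), and the second
component is `φ(x)`. -/
abbrev ConstructionData : Type := Omega1 → Set Omega1 × Finset ℝ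

namespace ConstructionData

/-- The set `U_γ`. -/
def uSet (D : ConstructionData) (γ : Omega1) : Set Omega1 := {x | x ≤ γ ∨ γ ∈ (D x).1}

/-- The set `U^α_γ`. -/
def levelSet (D : ConstructionData) (α γ : Omega1) : Set Omega1 := D.uSet γ ∩ Iic α

/-- The map `φ_α`, which is a restriction of one and the same map for all `α`. -/
def levelMap (D : ConstructionData) (_ γ : Omega1) : Finset ℝ := (D γ).2

/-- A basic open set of the final topology. -/
def nbhd (D : ConstructionData) (G : Finset Omega1) (W : Set (Finset ℝ)) : Set Omega1 :=
  basicNbhd D.uSet (fun x => (D x).2) G W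

/-- The requirements on the construction at stage `α`, in terms of basic open sets. -/
structure GoodAt (κ : Cardinal.{0}) (C : Omega1 → Set Omega1) (B : Omega1 → Set (Finset Omega1))
    (D : ConstructionData) (α : Omega1) : Prop where
  nonempty : (D α).2.Nonempty
  disjoint : ∀ γ < α, Disjoint (D γ).2 (D α).2
  /-- If `C α` is closed discrete below `α`, then `α` is in no `U_γ` with `γ ∈ C α`. -/
  avoid : (∀ β < α, ∃ G, ∃ W ∈ ratStars, β ∈ D.nbhd G W ∧ D.nbhd G W ∩ C α ⊆ {β}) →
    Disjoint (D α).1 (C α)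
  piNetwork : IsGuessed κ B D.levelSet D.levelMap α → ∀ G, ∀ W ∈ ratStars, α ∈ D.nbhd G W →
    ∃ F ∈ B α, (F : Set Omega1) ⊆ D.nbhd G W
  cover : ∀ β < α, IsGuessed κ B D.levelSet D.levelMap β → ∀ G, ∀ W ∈ ratStars, β ∈ D.nbhd G W →
    ∀ K : Finset Omega1, (K : Set Omega1) ⊆ Ioc β α →
      ∃ F ∈ B β, (F : Set Omega1) ⊆ D.nbhd G W ∧ ∀ γ ∈ F, (K : Set Omega1) ⊆ D.uSet γ

end ConstructionData

open ConstructionData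

/-- Whether `β` is guessed depends only on the part of the construction below `β`. -/
lemma IsGuessed.congr {κ : Cardinal.{0}} {B : Omega1 → Set (Finset Omega1)}
    {U U' : Omega1 → Omega1 → Set Omega1} {φ φ' : Omega1 → Omega1 → Finset ℝ} {β : Omega1}
    (hU : ∀ γ < β, U β γ ∩ Iio β = U' β γ ∩ Iio β) (hφ : ∀ γ < β, φ β γ = φ' β γ)
    (h : IsGuessed κ B U φ β) : IsGuessed κ B U' φ' β := by
  obtain ⟨h1, h2, θ, hθ, M, hM⟩ := h
  refine ⟨h1, h2, θ, hθ, M, { hM with exists_map := ?_, exists_sequence := ?_ }⟩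
  · obtain ⟨g, hg, hgf, hgr⟩ := hM.exists_map
    refine ⟨g, hg, hgf, hgr.trans ?_⟩
    ext p
    rw [mem_codeFun, mem_codeFun]
    refine exists_congr fun γ => and_congr_right fun hγ => ?_
    rw [hφ γ hγ]
  · obtain ⟨V, hV, h⟩ := hM.exists_sequence
    refine ⟨V, hV, fun γ hγ => (h γ hγ).trans ?_⟩
    simp only [hU γ hγ]

section Congr

variable {D D' : ConstructionData} {α : Omega1} {κ : Cardinal.{0}} {C : Omega1 → Set Omega1}
  {B : Omega1 → Set (Finset Omega1)}

lemma mem_uSet_congr {x : Omega1} (h : D x = D' x) (γ : Omega1) : x ∈ D.uSet γ ↔ x ∈ D'.uSet γ := by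
  simp [uSet, h]

lemma mem_nbhd_congr {x : Omega1} (h : D x = D' x) (G : Finset Omega1) (W : Set (Finset ℝ)) :
    x ∈ D.nbhd G W ↔ x ∈ D'.nbhd G W := by
  refine and_congr (forall₂_congr fun γ _ => mem_uSet_congr h γ) ?_
  simp only [h]

lemma isGuessed_congr (h : ∀ x < α, D x = D' x) (hg : IsGuessed κ B D.levelSet D.levelMap α) :
    IsGuessed κ B D'.levelSet D'.levelMap α := by
  refine hg.congr (fun γ _ => ?_) fun γ hγ => by simp only [levelMap, h γ hγ]
  ext x
  refine and_congr_left fun hx => and_congr_left fun _ => mem_uSet_congr (h x hx) γ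

lemma ConstructionData.GoodAt.congr (hC : ∀ α, C α ⊆ Iio α) (h : ∀ x ≤ α, D x = D' x)
    (hD : GoodAt κ C B D α) : GoodAt κ C B D' α := by
  have hsymm : ∀ x ≤ α, D' x = D x := fun x hx => (h x hx).symm
  refine ⟨?_, fun γ hγ => ?_, fun hcd => ?_, fun hg G W hW hα => ?_,
    fun β hβ hg G W hW hβN K hK => ?_⟩
  · rw [← h α le_rfl]; exact hD.nonempty
  · rw [← h α le_rfl, ← h γ hγ.le]; exact hD.disjoint γ hγ
  · rw [← h α le_rfl]
    refine hD.avoid fun β hβ => ?_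
    obtain ⟨G, W, hW, hβN, hsub⟩ := hcd β hβ
    refine ⟨G, W, hW, (mem_nbhd_congr (h β hβ.le) G W).2 hβN, fun x hx => ?_⟩
    exact hsub ⟨(mem_nbhd_congr (h x (hC α hx.2).le) G W).1 hx.1, hx.2⟩
  · have hg' := isGuessed_congr (fun x hx => hsymm x (le_of_lt hx)) hg
    obtain ⟨F, hF, hFN⟩ := hD.piNetwork hg' G W hW ((mem_nbhd_congr (h α le_rfl) G W).2 hα)
    exact ⟨F, hF, fun x hx => (mem_nbhd_congr (h x (hg.1 hF x hx).le) G W).1 (hFN hx)⟩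
  · have hg' := isGuessed_congr (fun x hx => hsymm x (hx.trans hβ).le) hg
    obtain ⟨F, hF, hFN, hFK⟩ := hD.cover β hβ hg' G W hW
      ((mem_nbhd_congr (h β hβ.le) G W).2 hβN) K hK
    refine ⟨F, hF, fun x hx => ?_, fun γ hγ x hx => ?_⟩
    · exact (mem_nbhd_congr (h x ((hg.1 hF x hx).trans hβ).le) G W).1 (hFN hx)
    · exact (mem_uSet_congr (h x (hK hx).2) γ).1 (hFK γ hγ hx)

end Congr

lemma exists_singleton_real_avoiding (h : Omega1 → Finset ℝ) (α : Omega1) :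
    ∃ r : ℝ, ∀ γ < α, r ∉ h γ := by
  have hc : (⋃ γ ∈ Iio α, (h γ : Set ℝ)).Countable :=
    (countable_Iio_omega1 α).biUnion fun γ _ => (h γ).countable_toSet
  by_contra! hcon
  refine Cardinal.not_countable_real (hc.mono fun r _ => ?_)
  obtain ⟨γ, hγ, hr⟩ := hcon r
  exact mem_biUnion (show γ ∈ Iio α from hγ) hr

/-- One step of the construction. The value at `α` is a pair `(a, b)`. The set `a` is a union of
members of the families `B β` with `β < α` guessed, one for each task: the task given by `β`, a
basic open set `N ∋ β` and a finite `K ⊆ (β, α)` asks for some `F ∈ B β` inside `N` with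
`K ⊆ U_F`, and then `F ⊆ a` means `K ∪ {α} ⊆ U_F`. If `C α` is closed discrete below `α`, only those
`N` are used that meet `C α` in `β` at most; as `F ⊆ β`, the set `a` avoids `C α`. -/
theorem exists_update_goodAt {κ : Cardinal.{0}} {C : Omega1 → Set Omega1}
    {B : Omega1 → Set (Finset Omega1)} (hκ : 2 ^ (ℵ₁ : Cardinal.{0}) ≤ κ)
    (hC : ∀ α, C α ⊆ Iio α) (hB : IsFinsetDiamondSeq B) (D : ConstructionData) (α : Omega1)
    (hD : ∀ γ < α, GoodAt κ C B D γ) : ∃ d, GoodAt κ C B (Function.update D α d) α := by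
  classical
  -- `C α` is closed discrete below `α`
  let CD : Prop := ∀ β < α, ∃ G, ∃ W ∈ ratStars, β ∈ D.nbhd G W ∧ D.nbhd G W ∩ C α ⊆ {β}
  -- the covering property at the earlier stages
  have hcov : ∀ β < α, IsGuessed κ B D.levelSet D.levelMap β → ∀ G, ∀ W ∈ ratStars,
      β ∈ D.nbhd G W → ∀ K : Finset Omega1, (K : Set Omega1) ⊆ Ioo β α →
      ∃ F ∈ B β, (F : Set Omega1) ⊆ D.nbhd G W ∧ ∀ γ ∈ F, (K : Set Omega1) ⊆ D.uSet γ := by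
    intro β hβ hg G W hW hβN K hK
    rcases K.eq_empty_or_nonempty with rfl | hne
    · obtain ⟨F, hF, hFN⟩ := (hD β hβ).piNetwork hg G W hW hβN
      exact ⟨F, hF, hFN, by simp⟩
    · have hm := hK (K.max'_mem hne)
      exact (hD _ hm.2).cover β hm.1 hg G W hW hβN K fun x hx =>
        ⟨(hK hx).1, K.le_max' x hx⟩
  -- the countably many tasks: for each, a member of `B β` has to be put into `{γ : α ∈ U_γ}`
  let Task : Set (Omega1 × Finset Omega1 × Set (Finset ℝ) × Finset Omega1) :=
    {t | t.1 < α ∧ IsGuessed κ B D.levelSet D.levelMap t.1 ∧ (∀ γ ∈ t.2.1, γ < α) ∧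
      t.2.2.1 ∈ ratStars ∧ t.1 ∈ D.nbhd t.2.1 t.2.2.1 ∧ (t.2.2.2 : Set Omega1) ⊆ Ioo t.1 α ∧
      (CD → D.nbhd t.2.1 t.2.2.1 ∩ C α ⊆ {t.1})}
  have hTask : Task.Countable := by
    refine ((countable_Iio_omega1 α).prod ((countable_finsetsBelow α).prod
      (ratStars_countable.prod (countable_finsetsBelow α)))).mono ?_
    rintro t ⟨h1, -, h3, h4, -, h6, -⟩
    exact ⟨h1, h3, h4, fun x hx => (h6 hx).2⟩
  have : Countable Task := hTask.to_subtype
  -- it suffices to select members for the tasks together with a suitable `b`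
  suffices hsel : ∃ S : Task → Finset Omega1,
      (∀ t, S t ∈ B t.1.1 ∧ (S t : Set Omega1) ⊆ D.nbhd t.1.2.1 t.1.2.2.1 ∧
        ∀ γ ∈ S t, (t.1.2.2.2 : Set Omega1) ⊆ D.uSet γ) ∧
      ∃ b : Finset ℝ, b.Nonempty ∧ (∀ γ < α, Disjoint (D γ).2 b) ∧
        (IsGuessed κ B D.levelSet D.levelMap α → ∀ G : Finset Omega1,
          (∀ γ ∈ G, ∃ t, γ ∈ S t) → ∀ W ∈ ratStars, b ∈ W →
          ∃ F ∈ B α, (F : Set Omega1) ⊆ D.nbhd G W) by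
    obtain ⟨S, hS, b, hbne, hbd, hbα⟩ := hsel
    refine ⟨(⋃ t, (S t : Set Omega1), b), ?_⟩
    set D' := Function.update D α (⋃ t, (S t : Set Omega1), b) with hD'
    have hαD : D' α = (⋃ t, (S t : Set Omega1), b) := Function.update_self ..
    have hlt : ∀ x < α, D' x = D x := fun x hx => Function.update_of_ne hx.ne _ _
    refine ⟨?_, ?_, ?_, ?_, ?_⟩
    · rw [hαD]; exact hbne
    · intro γ hγ
      rw [hαD, hlt γ hγ]; exact hbd γ hγ
    · intro hcd
      have hCD : CD := fun β hβ => by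
        obtain ⟨G, W, hW, hβN, hsub⟩ := hcd β hβ
        exact ⟨G, W, hW, (mem_nbhd_congr (hlt β hβ) G W).1 hβN, fun x hx =>
          hsub ⟨(mem_nbhd_congr (hlt x (hC α hx.2)) G W).2 hx.1, hx.2⟩⟩
      rw [hαD, disjoint_left]
      rintro γ hγ hγC
      obtain ⟨t, ht⟩ := mem_iUnion.1 hγ
      have h1 : γ < t.1.1 := t.2.2.1.1 (hS t).1 γ ht
      have h2 : γ = t.1.1 := t.2.2.2.2.2.2.2 hCD ⟨(hS t).2.1 ht, hγC⟩
      exact h1.ne h2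
    · intro hg G W hW hα
      have hg' := isGuessed_congr hlt hg
      -- members of `G` that are at least `α` impose no condition on subsets of `α`
      obtain ⟨F, hF, hFN⟩ := hbα hg' (G.filter (· < α)) (fun γ hγ => by
        obtain ⟨hγG, hγα⟩ := Finset.mem_filter.1 hγ
        rcases hα.1 γ hγG with h | h
        · exact absurd hγα h.not_gt
        · rw [hαD] at h
          exact mem_iUnion.1 h) W hW (by
        have := hα.2
        simp only [hαD] at this
        exact this)
      refine ⟨F, hF, fun x hx => ?_⟩
      have hxα : x < α := hg.1 hF x hx
      rw [mem_nbhd_congr (hlt x hxα)]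
      refine ⟨fun γ hγ => ?_, (hFN hx).2⟩
      by_cases hγα : γ < α
      · exact (hFN hx).1 γ (Finset.mem_filter.2 ⟨hγ, hγα⟩)
      · exact Or.inl (hxα.le.trans (not_lt.1 hγα))
    · intro β hβ hg G W hW hβN K hK
      have hg' := isGuessed_congr (fun x hx => hlt x (hx.trans hβ)) hg
      have hβN' := (mem_nbhd_congr (hlt β hβ) G W).1 hβN
      obtain ⟨G₁, W₁, hW₁, hβ₁, hsub⟩ : ∃ G₁, ∃ W₁ ∈ ratStars, β ∈ D.nbhd G₁ W₁ ∧
          (CD → D.nbhd G₁ W₁ ∩ C α ⊆ {β}) := by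
        by_cases hCD : CD
        · obtain ⟨G₁, W₁, hW₁, h1, h2⟩ := hCD β hβ
          exact ⟨G₁, W₁, hW₁, h1, fun _ => h2⟩
        · exact ⟨G, W, hW, hβN', fun h => absurd h hCD⟩
      obtain ⟨W₂, hW₂, hβ₂, hW₂s⟩ := ratStars_inter hW hW₁ hβN'.2 hβ₁.2
      let t : Omega1 × Finset Omega1 × Set (Finset ℝ) × Finset Omega1 :=
        (β, (G ∪ G₁).filter (· < α), W₂, K.filter (· < α))
      -- below `α` the basic open set of the task `t` is contained in those for `G` and `G₁`
      have hin : ∀ x < α, x ∈ D.nbhd t.2.1 t.2.2.1 → x ∈ D.nbhd G W ∧ x ∈ D.nbhd G₁ W₁ := by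
        intro x hx hxt
        have h1 : ∀ γ ∈ G ∪ G₁, x ∈ D.uSet γ := fun γ hγ => by
          by_cases hγα : γ < α
          · exact hxt.1 γ (Finset.mem_filter.2 ⟨hγ, hγα⟩)
          · exact Or.inl (hx.le.trans (not_lt.1 hγα))
        exact ⟨⟨fun γ hγ => h1 γ (Finset.mem_union_left _ hγ), (hW₂s hxt.2).1⟩,
          ⟨fun γ hγ => h1 γ (Finset.mem_union_right _ hγ), (hW₂s hxt.2).2⟩⟩
      have ht : t ∈ Task := by
        refine ⟨hβ, hg', fun γ hγ => (Finset.mem_filter.1 hγ).2, hW₂, ⟨fun γ hγ => ?_, hβ₂⟩,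
          fun x hx => ?_, fun hCD x hx => ?_⟩
        · rcases Finset.mem_union.1 (Finset.mem_filter.1 hγ).1 with h | h
          · exact hβN'.1 γ h
          · exact hβ₁.1 γ h
        · obtain ⟨h1, h2⟩ := Finset.mem_filter.1 (Finset.mem_coe.1 hx)
          exact ⟨(hK h1).1, h2⟩
        · exact hsub hCD ⟨(hin x (hC α hx.2) hx.1).2, hx.2⟩
      obtain ⟨hSB, hSN, hSK⟩ := hS ⟨t, ht⟩
      refine ⟨_, hSB, fun x hx => ?_, fun γ hγ x hx => ?_⟩
      · have hxα : x < α := (hg.1 hSB x hx).trans hβ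
        rw [mem_nbhd_congr (hlt x hxα)]
        exact (hin x hxα (hSN hx)).1
      · rcases (hK hx).2.lt_or_eq with h | rfl
        · rw [mem_uSet_congr (hlt x h)]
          exact hSK γ hγ (Finset.mem_coe.2 (Finset.mem_filter.2 ⟨hx, h⟩))
        · refine Or.inr ?_
          rw [hαD]
          exact mem_iUnion.2 ⟨⟨t, ht⟩, hγ⟩
  -- the selection is subject to a further condition only if `α` is guessed
  by_cases hg : IsGuessed κ B D.levelSet D.levelMap α
  swap
  · -- nothing is required of `b` but disjointness
    have := fun t : Task => hcov t.1.1 t.2.1 t.2.2.1 t.1.2.1 t.1.2.2.1 t.2.2.2.2.1 t.2.2.2.2.2.1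
      t.1.2.2.2 t.2.2.2.2.2.2.1
    choose S hSB hSN hSK using this
    obtain ⟨r, hr⟩ := exists_singleton_real_avoiding (fun γ => (D γ).2) α
    exact ⟨S, fun t => ⟨hSB t, hSN t, hSK t⟩, {r}, Finset.singleton_nonempty r,
      fun γ hγ => Finset.disjoint_singleton_right.2 (hr γ hγ), fun h => absurd h hg⟩
  obtain ⟨hBα, hBd, θ, hθ, M, hM⟩ := hg
  obtain ⟨𝓑, ψ, V, hR⟩ := hM.exists_reflection hB hκ hθ hBd hBα
    (fun γ hγ => (hD γ hγ).nonempty) fun γ hγ δ hδ hne => by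
      rcases lt_or_gt_of_ne hne with h | h
      · exact (hD δ hδ).disjoint γ h
      · exact ((hD γ hγ).disjoint δ h).symm
  have hlev : ∀ x ≤ α, ∀ γ, x ∈ D.levelSet α γ ↔ x ∈ D.uSet γ := fun x hx γ =>
    and_iff_left hx
  have hlevN : ∀ x ≤ α, ∀ G W,
      x ∈ basicNbhd (D.levelSet α) (D.levelMap α) G W ↔ x ∈ D.nbhd G W := fun x hx G W =>
    and_congr_left' (forall₂_congr fun γ _ => hlev x hx γ)
  obtain ⟨z, hz⟩ : ∃ z : ℕ → Finset ℝ, ∀ γ < α, ∃ n, z n = (D γ).2 := by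
    rcases (Iio α).eq_empty_or_nonempty with h | h
    · exact ⟨fun _ => ∅, fun γ hγ => absurd (show γ ∈ Iio α from hγ) (h ▸ notMem_empty γ)⟩
    · obtain ⟨f, hf⟩ := (countable_Iio_omega1 α).exists_eq_range h
      refine ⟨fun n => (D (f n)).2, fun γ hγ => ?_⟩
      obtain ⟨n, rfl⟩ : γ ∈ range f := hf ▸ hγ
      exact ⟨n, rfl⟩
  obtain ⟨S, hS, b, hbne, hbd, hbα⟩ := hR.exists_selection (T := Task)
    (β := fun t => t.1.1) (G := fun t => t.1.2.1) (W := fun t => t.1.2.2.1)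
    (K := fun t => t.1.2.2.2) (fun t => t.2.1) (fun t => t.2.2.1.1) (fun t => t.2.2.2.1)
    (fun t => t.2.2.2.2.1) (fun t γ hγ => (t.2.2.2.2.2.2.1 hγ).2)
    (fun t L hL hLt => by
      obtain ⟨F, hF, hFN, hFK⟩ := hcov t.1.1 t.2.1 t.2.2.1 t.1.2.1 t.1.2.2.1 t.2.2.2.2.1
        t.2.2.2.2.2.1 (t.1.2.2.2 ∪ L) (by
          intro x hx
          rcases Finset.mem_union.1 (Finset.mem_coe.1 hx) with h | h
          · exact t.2.2.2.2.2.2.1 h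
          · exact ⟨hLt x h, hBα hL x h⟩)
      refine ⟨F, hF, fun x hx => (hlevN x ((t.2.2.1.1 hF x hx).trans t.2.1).le _ _).2 (hFN hx),
        fun γ hγ x hx => ?_, fun γ hγ x hx => ?_⟩
      · exact (hlev x (t.2.2.2.2.2.2.1 hx).2.le γ).2
          (hFK γ hγ (Finset.mem_coe.2 (Finset.mem_union_left _ hx)))
      · exact (hlev x (hBα hL x hx).le γ).2
          (hFK γ hγ (Finset.mem_coe.2 (Finset.mem_union_right _ hx)))) z
  refine ⟨S, fun t => ⟨(hS t).1, fun x hx => ?_, fun γ hγ x hx => ?_⟩, b, hbne, fun γ hγ => ?_,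
    fun _ G hG W hW hbW => ?_⟩
  · exact (hlevN x ((t.2.2.1.1 (hS t).1 x hx).trans t.2.1).le _ _).1 ((hS t).2.1 hx)
  · exact (hlev x (t.2.2.2.2.2.2.1 hx).2.le γ).1 ((hS t).2.2 γ hγ hx)
  · obtain ⟨n, hn⟩ := hz γ hγ
    exact hn ▸ (hbd n).symm
  · obtain ⟨L, hL, hLN⟩ := hbα G hG W hW hbW
    exact ⟨L, hL, fun x hx => (hlevN x (hBα hL x hx).le G W).1 (hLN hx)⟩

/-- Recursion along `ω₁`. The requirements at `α` depend only on the values up to `α`, hence are not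
affected by later steps. -/
theorem exists_forall_goodAt {κ : Cardinal.{0}} {C : Omega1 → Set Omega1}
    {B : Omega1 → Set (Finset Omega1)} (hκ : 2 ^ (ℵ₁ : Cardinal.{0}) ≤ κ)
    (hC : ∀ α, C α ⊆ Iio α) (hB : IsFinsetDiamondSeq B) :
    ∃ D : ConstructionData, ∀ α, GoodAt κ C B D α := by
  classical
  choose! next hnext using fun (D : ConstructionData) (α : Omega1) =>
    exists_update_goodAt hκ hC hB D α
  let D : ConstructionData := WellFoundedLT.fix (motive := fun _ => Set Omega1 × Finset ℝ)
    fun α F => next (fun x => if h : x < α then F x h else (∅, ∅)) α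
  -- the step from `D ↾ α` to `D α` is given by `next`, applied to an arbitrary extension of `D ↾ α`
  let trunc : Omega1 → ConstructionData := fun α x => if x < α then D x else (∅, ∅)
  have hDα : ∀ α, D α = next (trunc α) α := by
    intro α
    change WellFoundedLT.fix _ α = _
    rw [WellFoundedLT.fix_eq]
    congr 1
  refine ⟨D, fun α => ?_⟩
  induction α using WellFoundedLT.induction with
  | _ α ih =>
    have h1 : ∀ γ < α, GoodAt κ C B (trunc α) γ := fun γ hγ =>
      (ih γ hγ).congr hC fun x hx => by simp [trunc, hx.trans_lt hγ]
    refine (hnext _ _ h1).congr hC fun x hx => ?_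
    rcases hx.lt_or_eq with h | rfl
    · rw [Function.update_of_ne h.ne]
      simp [trunc, h]
    · rw [Function.update_self, hDα]

/-! ### Basic open sets, and the existence of a construction -/

/-- In a topology generated by sets `u γ` and preimages of members of `𝒲` under `h`, every point of
an open set has a neighbourhood inside it given by finitely many `γ` and a single member of `𝒲`. -/
lemma exists_basic_of_generateOpen {X : Type*} {𝒮 : Set (Set X)} {I : Set Omega1}
    {u : Omega1 → Set X} {h : X → Finset ℝ}
    (h𝒮 : ∀ s ∈ 𝒮, (∃ γ ∈ I, s = u γ) ∨ ∃ W ∈ ratStars, s = h ⁻¹' W) {V : Set X}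
    (hV : IsOpen[TopologicalSpace.generateFrom 𝒮] V) {x : X} (hx : x ∈ V) :
    ∃ G : Finset Omega1, (G : Set Omega1) ⊆ I ∧ ∃ W ∈ ratStars, (∀ γ ∈ G, x ∈ u γ) ∧ h x ∈ W ∧
      ∀ y, (∀ γ ∈ G, y ∈ u γ) → h y ∈ W → y ∈ V := by
  classical
  have huniv : ∃ W ∈ ratStars, h x ∈ W := by
    obtain ⟨W, hW, hxW, -⟩ := exists_ratStar (h x) isOpen_univ (subset_univ _)
    exact ⟨W, hW, hxW⟩
  have hV' : TopologicalSpace.GenerateOpen 𝒮 V := hV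
  clear hV
  induction hV' with
  | basic s hs =>
    rcases h𝒮 s hs with ⟨γ, hγ, rfl⟩ | ⟨W, hW, rfl⟩
    · obtain ⟨W, hW, hxW⟩ := huniv
      exact ⟨{γ}, by simpa using hγ, W, hW, by simpa using hx, hxW, fun y hy _ => by simpa using hy⟩
    · exact ⟨∅, by simp, W, hW, by simp, hx, fun y _ hy => hy⟩
  | univ =>
    obtain ⟨W, hW, hxW⟩ := huniv
    exact ⟨∅, by simp, W, hW, by simp, hxW, fun y _ _ => mem_univ y⟩
  | inter s t _ _ ihs iht =>
    obtain ⟨G, hG, W, hW, h1, h2, h3⟩ := ihs hx.1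
    obtain ⟨G', hG', W', hW', h1', h2', h3'⟩ := iht hx.2
    obtain ⟨W'', hW'', hx'', hsub⟩ := ratStars_inter hW hW' h2 h2'
    refine ⟨G ∪ G', by simpa using And.intro hG hG', W'', hW'', fun γ hγ => ?_, hx'',
      fun y hy hyW => ⟨h3 y (fun γ hγ => hy γ (Finset.mem_union_left _ hγ)) (hsub hyW).1,
        h3' y (fun γ hγ => hy γ (Finset.mem_union_right _ hγ)) (hsub hyW).2⟩⟩
    rcases Finset.mem_union.1 hγ with h | h
    · exact h1 γ h
    · exact h1' γ h
  | sUnion S _ ih =>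
    obtain ⟨s, hs, hxs⟩ := hx
    obtain ⟨G, hG, W, hW, h1, h2, h3⟩ := ih s hs hxs
    exact ⟨G, hG, W, hW, h1, h2, fun y hy hyW => ⟨s, hs, h3 y hy hyW⟩⟩

lemma exists_basic_levelTopology {U : Omega1 → Omega1 → Set Omega1}
    {φ : Omega1 → Omega1 → Finset ℝ} {α : Omega1} {V : Set (Iic α)}
    (hV : IsOpen[levelTopology U φ α] V) {x : Iic α} (hx : x ∈ V) :
    ∃ G : Finset Omega1, (∀ γ ∈ G, γ ≤ α) ∧ ∃ W ∈ ratStars,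
      (x : Omega1) ∈ basicNbhd (U α) (φ α) G W ∧
      ∀ y : Iic α, (y : Omega1) ∈ basicNbhd (U α) (φ α) G W → y ∈ V := by
  obtain ⟨G, hG, W, hW, h1, h2, h3⟩ := exists_basic_of_generateOpen (I := Iic α)
    (u := fun γ => {x : Iic α | (x : Omega1) ∈ U α γ}) (h := fun x : Iic α => φ α x)
    (fun s hs => hs) hV hx
  exact ⟨G, hG, W, hW, ⟨h1, h2⟩, fun y hy => h3 y hy.1 hy.2⟩

lemma exists_basic_limitTopology {U : Omega1 → Omega1 → Set Omega1}
    {φ : Omega1 → Omega1 → Finset ℝ} {V : Set Omega1}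
    (hV : IsOpen[limitTopology U φ] V) {x : Omega1} (hx : x ∈ V) :
    ∃ G : Finset Omega1, ∃ W ∈ ratStars, x ∈ basicNbhd (limitSet U) (limitMap φ) G W ∧
      basicNbhd (limitSet U) (limitMap φ) G W ⊆ V := by
  obtain ⟨G, -, W, hW, h1, h2, h3⟩ := exists_basic_of_generateOpen (I := univ)
    (u := limitSet U) (h := limitMap φ)
    (fun s hs => hs.imp (fun ⟨γ, h⟩ => ⟨γ, mem_univ γ, h⟩) id) hV hx
  exact ⟨G, W, hW, ⟨h1, h2⟩, fun y hy => h3 y hy.1 hy.2⟩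

theorem ConstructionData.isConstruction {κ : Cardinal.{0}} {C : Omega1 → Set Omega1}
    {B : Omega1 → Set (Finset Omega1)} (hC : ∀ α, C α ⊆ Iio α) {D : ConstructionData}
    (hD : ∀ α, GoodAt κ C B D α) : IsConstruction κ C B D.levelSet D.levelMap where
  subset _ _ _ := inter_subset_right
  self α := inter_eq_right.2 fun _ hx => Or.inl hx
  nonempty _ γ _ := (hD γ).nonempty
  disjoint _ γ _ δ _ hne := by
    rcases lt_or_gt_of_ne hne with h | h
    · exact (hD δ).disjoint γ h
    · exact ((hD γ).disjoint δ h).symm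
  coherent_set α₀ α hα γ _ := by
    rw [levelSet, levelSet, inter_assoc, inter_eq_right.2 (Iic_subset_Iic.2 hα)]
  coherent_map _ _ _ _ _ := rfl
  not_cover α hcd := by
    have hdisj : Disjoint (D α).1 (C α) := by
      refine (hD α).avoid fun β hβ => ?_
      obtain ⟨hcl, hdisc⟩ := hcd
      let _ := levelTopology D.levelSet D.levelMap α
      -- a neighbourhood of `β` that meets `C α` in `β` at most
      obtain ⟨V, hV, hβV, hVs⟩ : ∃ V : Set (Iic α), IsOpen V ∧ (⟨β, hβ.le⟩ : Iic α) ∈ V ∧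
          ∀ y ∈ V, (y : Omega1) ∈ C α → (y : Omega1) = β := by
        by_cases hβC : β ∈ C α
        · obtain ⟨V, hV, hVs⟩ := isDiscrete_iff_forall_mem_exists_isOpen.1 hdisc ⟨β, hβ.le⟩ hβC
          refine ⟨V, hV, (hVs.ge rfl).1, fun y hy hyC => ?_⟩
          exact congrArg Subtype.val (hVs.le ⟨hy, hyC⟩)
        · exact ⟨_, hcl.isOpen_compl, hβC, fun y hy hyC => absurd hyC hy⟩
      obtain ⟨G, -, W, hW, hN, hNV⟩ := exists_basic_levelTopology hV hβV
      refine ⟨G, W, hW, ⟨fun γ hγ => (hN.1 γ hγ).1, hN.2⟩, fun y hy => ?_⟩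
      have hyα : y ≤ α := (hC α hy.2).le
      exact hVs ⟨y, hyα⟩ (hNV _ ⟨fun γ hγ => ⟨hy.1.1 γ hγ, hyα⟩, hy.1.2⟩) hy.2
    intro hcov
    have hα : α ∈ ⋃ γ ∈ C α, D.levelSet α γ := hcov ▸ self_mem_Iic
    obtain ⟨γ, hγC, hγ⟩ := mem_iUnion₂.1 hα
    rcases hγ.1 with h | h
    · exact (hC α hγC).not_ge h
    · exact disjoint_left.1 hdisj h hγC
  piNetwork α β hβ hg V hV hβV := by
    obtain ⟨G, -, W, hW, hN, hNV⟩ := exists_basic_levelTopology hV hβV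
    obtain ⟨F, hF, hFN⟩ := (hD β).piNetwork hg.2 G W hW ⟨fun γ hγ => (hN.1 γ hγ).1, hN.2⟩
    refine ⟨_, ⟨F, hF, rfl⟩, fun x hx => hNV x ⟨fun γ hγ => ⟨(hFN hx).1 γ hγ, x.2⟩, (hFN hx).2⟩⟩
  omegaCover α β hβ hg V hV hβV K hK := by
    obtain ⟨G, -, W, hW, hN, hNV⟩ := exists_basic_levelTopology hV hβV
    obtain ⟨F, hF, hFN, hFK⟩ := (hD α).cover β hβ hg.2 G W hW
      ⟨fun γ hγ => (hN.1 γ hγ).1, hN.2⟩ K hK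
    refine ⟨_, ⟨F, hF, fun x hx => ?_, rfl⟩, fun x hx => ⟨(hK hx).2, fun γ hγ =>
      ⟨hFK γ hγ hx, (hK hx).2⟩⟩⟩
    have hxα : x ≤ α := ((hg.2.1 hF x hx).trans hβ).le
    exact ⟨⟨x, hxα⟩, hNV _ ⟨fun γ hγ => ⟨(hFN hx).1 γ hγ, hxα⟩, (hFN hx).2⟩, rfl⟩

/-! ### Properties of the final space -/

lemma exists_maximal_pairwiseDisjoint (𝓖 : Set (Finset Omega1)) :
    ∃ 𝓑 ⊆ 𝓖, 𝓑.PairwiseDisjoint id ∧ ∀ G ∈ 𝓖, (∀ L ∈ 𝓑, Disjoint G L) → G ∈ 𝓑 := by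
  obtain ⟨𝓑, h𝓑⟩ := zorn_subset {𝓑 : Set (Finset Omega1) | 𝓑 ⊆ 𝓖 ∧ 𝓑.PairwiseDisjoint id}
    fun c hc hchain => ⟨⋃₀ c, ⟨sUnion_subset fun s hs => (hc hs).1,
      (pairwiseDisjoint_sUnion hchain.directedOn).2 fun s hs => (hc hs).2⟩,
      fun s hs => subset_sUnion_of_mem hs⟩
  refine ⟨𝓑, h𝓑.prop.1, h𝓑.prop.2, fun G hG hdisj => ?_⟩
  have : insert G 𝓑 ⊆ 𝓑 := h𝓑.2
    ⟨insert_subset hG h𝓑.prop.1, h𝓑.prop.2.insert fun L hL _ => hdisj L hL⟩ (subset_insert G 𝓑)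
  exact this (mem_insert G 𝓑)

/-- If every uncountable disjoint family `𝓑` of finite sets has a countable subfamily whose
intersections `U_F` cover a final segment of `ω₁`, then every family of such intersections has a
countable subfamily with the same union. For sets of fixed size this goes by induction on the
size: when a maximal disjoint subfamily is countable, every member of the family contains one of
countably many ordinals, and these ordinals can be removed. -/
lemma exists_countable_subfamily {u : Omega1 → Set Omega1}
    (hu : ∀ 𝓑 : Set (Finset Omega1), ¬ 𝓑.Countable → 𝓑.PairwiseDisjoint id →
      ∃ β, ∃ 𝓑' ⊆ 𝓑, 𝓑'.Countable ∧ ∀ x, β < x → ∃ F ∈ 𝓑', ∀ γ ∈ F, x ∈ u γ)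
    (𝓖 : Set (Finset Omega1)) :
    ∃ 𝓖' ⊆ 𝓖, 𝓖'.Countable ∧
      ∀ x, ∀ G ∈ 𝓖, (∀ γ ∈ G, x ∈ u γ) → ∃ G' ∈ 𝓖', ∀ γ ∈ G', x ∈ u γ := by
  classical
  have key : ∀ n : ℕ, ∀ 𝓖 : Set (Finset Omega1), (∀ G ∈ 𝓖, G.card = n) →
      ∃ 𝓖' ⊆ 𝓖, 𝓖'.Countable ∧
        ∀ x, ∀ G ∈ 𝓖, (∀ γ ∈ G, x ∈ u γ) → ∃ G' ∈ 𝓖', ∀ γ ∈ G', x ∈ u γ := by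
    intro n
    induction n with
    | zero =>
      intro 𝓖 h
      refine ⟨𝓖, subset_rfl, Set.Subsingleton.countable fun G hG G' hG' => ?_,
        fun x G hG hx => ⟨G, hG, hx⟩⟩
      rw [Finset.card_eq_zero.1 (h G hG), Finset.card_eq_zero.1 (h G' hG')]
    | succ n ih =>
      intro 𝓖 h
      obtain ⟨𝓑, h𝓑𝓖, h𝓑d, h𝓑max⟩ := exists_maximal_pairwiseDisjoint 𝓖
      by_cases h𝓑c : 𝓑.Countable
      · have hmeet : ∀ G ∈ 𝓖, ∃ d ∈ G, d ∈ ⋃ L ∈ 𝓑, (L : Set Omega1) := by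
          intro G hG
          by_contra! hcon
          have hG𝓑 : G ∈ 𝓑 := h𝓑max G hG fun L hL =>
            Finset.disjoint_left.2 fun d hd hdL => hcon d hd (mem_biUnion hL hdL)
          obtain ⟨d, hd⟩ : G.Nonempty := Finset.card_pos.1 (by rw [h G hG]; exact n.succ_pos)
          exact hcon d hd (mem_biUnion hG𝓑 hd)
        have hDc : (⋃ L ∈ 𝓑, (L : Set Omega1)).Countable :=
          h𝓑c.biUnion fun L _ => L.countable_toSet
        have := fun d : Omega1 => ih {H | d ∉ H ∧ insert d H ∈ 𝓖} fun H hH => by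
          have := h _ hH.2
          rw [Finset.card_insert_of_notMem hH.1] at this
          exact Nat.succ_injective this
        choose 𝓗 h𝓗s h𝓗c h𝓗 using this
        refine ⟨⋃ d ∈ ⋃ L ∈ 𝓑, (L : Set Omega1), insert d '' 𝓗 d, ?_,
          hDc.biUnion fun d _ => (h𝓗c d).image _, fun x G hG hx => ?_⟩
        · refine iUnion₂_subset fun d _ => ?_
          rintro _ ⟨H, hH, rfl⟩
          exact (h𝓗s d hH).2
        · obtain ⟨d, hdG, hdD⟩ := hmeet G hG
          obtain ⟨H, hH, hxH⟩ := h𝓗 d x (G.erase d)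
            ⟨Finset.notMem_erase d G, by rwa [Finset.insert_erase hdG]⟩
            fun γ hγ => hx γ (Finset.mem_of_mem_erase hγ)
          refine ⟨_, mem_biUnion hdD (mem_image_of_mem _ hH), fun γ hγ => ?_⟩
          rcases Finset.mem_insert.1 hγ with rfl | hγ
          · exact hx γ hdG
          · exact hxH γ hγ
      · obtain ⟨β, 𝓑', h𝓑', h𝓑'c, hcov⟩ := hu 𝓑 h𝓑c h𝓑d
        have hsel : ∀ x : Omega1, ∃ 𝓢 ⊆ 𝓖, 𝓢.Countable ∧
            ∀ G ∈ 𝓖, (∀ γ ∈ G, x ∈ u γ) → ∃ G' ∈ 𝓢, ∀ γ ∈ G', x ∈ u γ := by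
          intro x
          by_cases hx : ∃ G ∈ 𝓖, ∀ γ ∈ G, x ∈ u γ
          · obtain ⟨G, hG, hxG⟩ := hx
            exact ⟨{G}, singleton_subset_iff.2 hG, countable_singleton G,
              fun _ _ _ => ⟨G, rfl, hxG⟩⟩
          · exact ⟨∅, empty_subset _, countable_empty, fun G hG hxG => absurd ⟨G, hG, hxG⟩ hx⟩
        choose 𝓢 h𝓢s h𝓢c h𝓢 using hsel
        refine ⟨𝓑' ∪ ⋃ x ∈ Iic β, 𝓢 x, union_subset (h𝓑'.trans h𝓑𝓖) (iUnion₂_subset fun x _ => h𝓢s x),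
          h𝓑'c.union ((countable_Iic_omega1 β).biUnion fun x _ => h𝓢c x), fun x G hG hxG => ?_⟩
        rcases le_or_gt x β with hxβ | hxβ
        · obtain ⟨G', hG', h'⟩ := h𝓢 x G hG hxG
          exact ⟨G', Or.inr (mem_biUnion (show x ∈ Iic β from hxβ) hG'), h'⟩
        · obtain ⟨F, hF, hxF⟩ := hcov x hxβ
          exact ⟨F, Or.inl hF, hxF⟩
  choose 𝓗 h𝓗s h𝓗c h𝓗 using fun n : ℕ => key n {G ∈ 𝓖 | G.card = n} fun G hG => hG.2
  refine ⟨⋃ n, 𝓗 n, iUnion_subset fun n => (h𝓗s n).trans (sep_subset _ _),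
    countable_iUnion h𝓗c, fun x G hG hx => ?_⟩
  obtain ⟨G', hG', h'⟩ := h𝓗 G.card x G ⟨hG, rfl⟩ hx
  exact ⟨G', mem_iUnion.2 ⟨_, hG'⟩, h'⟩

lemma isOpen_limitSet (U : Omega1 → Omega1 → Set Omega1) (φ : Omega1 → Omega1 → Finset ℝ)
    (γ : Omega1) : IsOpen[limitTopology U φ] (limitSet U γ) :=
  TopologicalSpace.isOpen_generateFrom_of_mem (Or.inl ⟨γ, rfl⟩)

lemma isOpen_limitMap_preimage (U : Omega1 → Omega1 → Set Omega1) (φ : Omega1 → Omega1 → Finset ℝ)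
    {W : Set (Finset ℝ)} (hW : W ∈ ratStars) : IsOpen[limitTopology U φ] (limitMap φ ⁻¹' W) :=
  TopologicalSpace.isOpen_generateFrom_of_mem (Or.inr ⟨W, hW, rfl⟩)

namespace IsConstruction

variable {κ : Cardinal.{0}} {C : Omega1 → Set Omega1} {B : Omega1 → Set (Finset Omega1)}
  {U : Omega1 → Omega1 → Set Omega1} {φ : Omega1 → Omega1 → Finset ℝ}

lemma mem_limitSet_iff (h : IsConstruction κ C B U φ) {α γ x : Omega1} (hγ : γ ≤ α) (hx : x ≤ α) :
    x ∈ limitSet U γ ↔ x ∈ U α γ := by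
  refine ⟨?_, fun hxU => ⟨α, hγ, hxU⟩⟩
  rintro ⟨α', hγ', hx'⟩
  have h1 : x ∈ U (max α α') γ := by
    rw [h.coherent_set _ α' (le_max_right _ _) γ hγ'] at hx'
    exact hx'.1
  rw [h.coherent_set _ α (le_max_left _ _) γ hγ]
  exact ⟨h1, hx⟩

lemma limitMap_eq (h : IsConstruction κ C B U φ) {α γ : Omega1} (hγ : γ ≤ α) :
    limitMap φ γ = φ α γ := h.coherent_map α γ hγ γ le_rfl

lemma mem_limitSet_of_le (h : IsConstruction κ C B U φ) {x γ : Omega1} (hx : x ≤ γ) :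
    x ∈ limitSet U γ := by
  rw [h.mem_limitSet_iff le_rfl hx, h.self]
  exact hx

lemma disjoint_limitMap (h : IsConstruction κ C B U φ) {x y : Omega1} (hxy : x ≠ y) :
    Disjoint (limitMap φ x) (limitMap φ y) := by
  rw [h.limitMap_eq (le_max_left x y), h.limitMap_eq (le_max_right x y)]
  exact h.disjoint _ x (le_max_left x y) y (le_max_right x y) hxy

/-- The points of the final space are separated by preimages of members of `𝒲`, since their images
are disjoint finite sets of reals. -/
lemma exists_separating (h : IsConstruction κ C B U φ) {x y : Omega1} (hxy : x ≠ y) :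
    ∃ W ∈ ratStars, ∃ W' ∈ ratStars, limitMap φ x ∈ W ∧ limitMap φ y ∈ W' ∧
      Disjoint (limitMap φ ⁻¹' W) (limitMap φ ⁻¹' W') := by
  obtain ⟨O, O', hO, hO', hx, hy, hd⟩ := SeparatedNhds.of_finset_finset _ _ (h.disjoint_limitMap hxy)
  obtain ⟨W, hW, hxW, hWO⟩ := exists_ratStar _ hO hx
  obtain ⟨W', hW', hyW', hWO'⟩ := exists_ratStar _ hO' hy
  refine ⟨W, hW, W', hW', hxW, hyW', disjoint_left.2 fun z hz hz' => ?_⟩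
  obtain ⟨r, hr⟩ : (limitMap φ z).Nonempty := h.nonempty z z le_rfl
  exact disjoint_left.1 hd (hWO hz hr) (hWO' hz' hr)

theorem t2Space (h : IsConstruction κ C B U φ) : @T2Space Omega1 (limitTopology U φ) := by
  let _ := limitTopology U φ
  refine ⟨fun x y hxy => ?_⟩
  obtain ⟨W, hW, W', hW', hx, hy, hd⟩ := h.exists_separating hxy
  exact ⟨_, _, isOpen_limitMap_preimage U φ hW, isOpen_limitMap_preimage U φ hW', hx, hy, hd⟩

theorem hasCountablePsiWeight (h : IsConstruction κ C B U φ) :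
    HasCountablePsiWeight (limitTopology U φ) := by
  refine ⟨(limitMap φ ⁻¹' ·) '' ratStars, ratStars_countable.image _, ?_, fun x => ?_⟩
  · rintro _ ⟨W, hW, rfl⟩
    exact isOpen_limitMap_preimage U φ hW
  · refine Subset.antisymm (fun y hy => ?_) ?_
    · by_contra hne
      obtain ⟨W, hW, W', -, hx, hy', hd⟩ := h.exists_separating (x := x) (y := y) (Ne.symm hne)
      exact disjoint_left.1 hd (hy _ ⟨mem_image_of_mem _ hW, hx⟩) hy'
    · rintro _ rfl V hV
      exact hV.2

/-- A guessed `β` provides the countable family `B β ⊆ 𝓑` needed in `exists_countable_subfamily`: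
by the covering property for `V = α + 1` the sets `U_F` with `F ∈ B β` cover `(β, ω₁)`. For each of
the countably many `W ∈ 𝒲` that lemma is applied to the sets `G` whose basic open sets lie in a
member of the given cover. -/
theorem hereditarilyLindelofSpace (h : IsConstruction κ C B U φ)
    (hguess : ∀ 𝓑 : Set (Finset Omega1), ¬ 𝓑.Countable → 𝓑.PairwiseDisjoint id →
      ∃ β, IsGuessed κ B U φ β ∧ B β ⊆ 𝓑) :
    @HereditarilyLindelofSpace Omega1 (limitTopology U φ) := by
  have hsub := exists_countable_subfamily (u := limitSet U) fun 𝓑 h𝓑 h𝓑d => by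
    obtain ⟨β, hg, hβ𝓑⟩ := hguess 𝓑 h𝓑 h𝓑d
    refine ⟨β, B β, hβ𝓑, (countable_finsetsBelow β).mono hg.1, fun x hx => ?_⟩
    obtain ⟨_, ⟨F, hF, -, rfl⟩, hxF⟩ := h.omegaCover x β hx ⟨hx.le, hg⟩ univ
      (@isOpen_univ _ (levelTopology U φ x)) (mem_univ _) {x} (by simpa using hx)
    have hxF' : x ∈ levelInter U x F := hxF (by simp)
    exact ⟨F, hF, fun γ hγ => ⟨x, ((hg.1 hF γ hγ).trans hx).le, hxF'.2 γ hγ⟩⟩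
  let _ := limitTopology U φ
  refine ⟨fun s _ => isLindelof_of_countable_subcover fun {ι} V hV hs => ?_⟩
  rcases isEmpty_or_nonempty ι with _ | _
  · exact ⟨∅, countable_empty, by simpa using hs⟩
  choose 𝓖 h𝓖s h𝓖c h𝓖 using fun W : Set (Finset ℝ) =>
    hsub {G | ∃ i, basicNbhd (limitSet U) (limitMap φ) G W ⊆ V i}
  choose! i hi using h𝓖s
  refine ⟨⋃ W ∈ ratStars, i W '' 𝓖 W,
    ratStars_countable.biUnion fun W _ => (h𝓖c W).image _, fun x hx => ?_⟩
  obtain ⟨j, hj⟩ := mem_iUnion.1 (hs hx)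
  obtain ⟨G, W, hW, hxG, hsubV⟩ := exists_basic_limitTopology (hV j) hj
  obtain ⟨G', hG', hxG'⟩ := h𝓖 W x G ⟨j, hsubV⟩ hxG.1
  exact mem_biUnion (mem_biUnion hW (mem_image_of_mem _ hG')) (hi W hG' ⟨hxG', hxG.2⟩)

/-- For `γ ≥ α` the set `U_γ` contains `α + 1`, so that `τ_α` is finer than the subspace
topology. -/
lemma continuous_val (h : IsConstruction κ C B U φ) (α : Omega1) :
    @Continuous (Iic α) Omega1 (levelTopology U φ α) (limitTopology U φ) Subtype.val := by
  refine continuous_generateFrom_iff.2 ?_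
  rintro s (⟨γ, rfl⟩ | ⟨W, hW, rfl⟩)
  · rcases le_total γ α with hγ | hγ
    · refine TopologicalSpace.isOpen_generateFrom_of_mem (Or.inl ⟨γ, hγ, ?_⟩)
      ext x
      exact h.mem_limitSet_iff hγ x.2
    · convert isOpen_univ
      exact eq_univ_of_forall fun x : Iic α => h.mem_limitSet_of_le (le_trans x.2 hγ)
  · refine TopologicalSpace.isOpen_generateFrom_of_mem (Or.inr ⟨W, hW, ?_⟩)
    ext x
    change limitMap φ x ∈ W ↔ φ α x ∈ W
    rw [h.limitMap_eq x.2]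

/-- The neighbourhood assignment `γ ↦ U_γ` has no closed discrete kernel: such a set is countable,
hence is some `C α`, and it remains closed discrete in `τ_α`, so that it does not cover `α + 1`. -/
theorem not_isDSpace (h : IsConstruction κ C B U φ) (hC : EnumeratesCountableSets C)
    (hL : @HereditarilyLindelofSpace Omega1 (limitTopology U φ)) :
    ¬ IsDSpace (limitTopology U φ) := by
  intro hD
  obtain ⟨E, ⟨hEc, hEd⟩, hEcov⟩ := hD (limitSet U) fun x =>
    ⟨isOpen_limitSet U φ x, h.mem_limitSet_of_le le_rfl⟩
  have hE : E.Countable := by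
    let _ := limitTopology U φ
    exact (HereditarilyLindelofSpace.isLindelof E).countable_of_isDiscrete hEd
  obtain ⟨α, rfl⟩ : E ∈ range C := hC.1 ▸ hE
  refine h.not_cover α ⟨?_, ?_⟩ ?_
  · exact @IsClosed.preimage _ _ (levelTopology U φ α) (limitTopology U φ) _ (h.continuous_val α)
      _ hEc
  · let _ := levelTopology U φ α
    let _ := limitTopology U φ
    exact hEd.preimage (f := ((↑) : Iic α → Omega1)) (h.continuous_val α).continuousOn
      Subtype.val_injective
  · refine Subset.antisymm (iUnion₂_subset fun γ hγ => h.subset α γ (hC.2 α hγ).le) fun x hx => ?_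
    obtain ⟨γ, hγ, hxγ⟩ := mem_iUnion₂.1 (hEcov.ge (mem_univ x))
    exact mem_biUnion hγ ((h.mem_limitSet_iff (hC.2 α hγ).le hx).1 hxγ)

end IsConstruction

/-! ### Existence of guessing models -/

instance : setTheoryLanguage.IsRelational := fun _ => inferInstanceAs (IsEmpty Empty)

lemma card_setTheoryLanguage_le : setTheoryLanguage.card ≤ ℵ₀ := by
  have h1 : Countable (Σ n, setTheoryLanguage.Functions n) := inferInstance
  have h2 : Countable (Σ n, setTheoryLanguage.Relations n) := by
    have : ∀ n, Countable (setTheoryLanguage.Relations n) := fun n => by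
      refine Set.countable_univ_iff.1 (Set.Subsingleton.countable ?_)
      rintro ⟨⟩ - ⟨⟩ -
      rfl
    infer_instance
  rw [FirstOrder.Language.card, Cardinal.mk_le_aleph0_iff]
  exact inferInstanceAs (Countable (_ ⊕ _))

/-- Löwenheim–Skolem with control of the countable ordinals: for club many `β < ω₁`, the closure
of given countably many parameters and of `β` under Skolem functions contains no further countable
ordinal. -/
lemma exists_club_submodel {θ : Cardinal.{0}} {P : Set (HSet θ)} (hP : P.Countable)
    {o : Omega1 → HSet θ} (ho : ∀ γ, (o γ).1 = codeOrd γ) :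
    ∃ E : Set Omega1, IsClub E ∧ ∀ β ∈ E,
      ∃ S : setTheoryLanguage.ElementarySubstructure (HSet θ), (S : Set (HSet θ)).Countable ∧
        P ⊆ S ∧ ∀ γ, o γ ∈ S ↔ γ < β := by
  classical
  have : Nonempty (HSet θ) := ⟨o (Classical.arbitrary _)⟩
  have : Countable (Σ n, (setTheoryLanguage.sum setTheoryLanguage.skolem₁).Functions n) := by
    rw [← Cardinal.mk_le_aleph0_iff]
    exact FirstOrder.Language.card_functions_sum_skolem₁_le.trans
      (max_le le_rfl card_setTheoryLanguage_le)
  have hinj : Function.Injective o := fun a b h => codeOrd_injective (by rw [← ho, ← ho, h])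
  let Cl := fun s : Set Omega1 => FirstOrder.Language.Substructure.closure
    (setTheoryLanguage.sum setTheoryLanguage.skolem₁) (P ∪ o '' s)
  have hCl : ∀ s : Set Omega1, s.Countable → (Cl s : Set (HSet θ)).Countable := fun s hs =>
    countable_coe_iff.1 ((hP.union (hs.image o)).substructure_closure
      (setTheoryLanguage.sum setTheoryLanguage.skolem₁))
  choose f hf using fun s : Finset Omega1 =>
    exists_gt_of_countable ((hCl s s.countable_toSet).preimage hinj)
  refine ⟨_, isClub_closed_finset f, fun β hβ => ?_⟩
  refine ⟨(Cl (Iio β)).elementarySkolem₁Reduct, hCl _ (countable_Iio_omega1 β), fun x hx =>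
    FirstOrder.Language.Substructure.subset_closure (Or.inl hx), fun γ => ⟨fun hγ => ?_, fun hγ =>
    FirstOrder.Language.Substructure.subset_closure (Or.inr ⟨γ, hγ, rfl⟩)⟩⟩
  -- the closure is finitary
  have key : ∃ s : Finset Omega1, (∀ x ∈ s, x < β) ∧ o γ ∈ Cl s := by
    refine FirstOrder.Language.Substructure.closure_induction
      (p := fun y => ∃ s : Finset Omega1, (∀ x ∈ s, x < β) ∧ y ∈ Cl s)
      (show o γ ∈ Cl (Iio β) from hγ) ?_ ?_
    · rintro x (hx | ⟨δ, hδ, rfl⟩)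
      · exact ⟨∅, by simp, FirstOrder.Language.Substructure.subset_closure (Or.inl hx)⟩
      · exact ⟨{δ}, by simpa using hδ,
          FirstOrder.Language.Substructure.subset_closure (Or.inr ⟨δ, by simp, rfl⟩)⟩
    · intro n F x hx
      choose s hs hxs using hx
      refine ⟨Finset.univ.biUnion s, fun y hy => ?_, (Cl _).fun_mem F x fun i => ?_⟩
      · obtain ⟨i, -, hi⟩ := Finset.mem_biUnion.1 hy
        exact hs i y hi
      · refine FirstOrder.Language.Substructure.closure_mono (union_subset_union_right P
          (image_mono ?_)) (hxs i)
        exact Finset.coe_subset.2 (Finset.subset_biUnion_of_mem s (Finset.mem_univ i))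
  obtain ⟨s, hs, hγs⟩ := key
  exact (hf s γ hγs).trans (hβ s hs)

lemma isFunctionSet_codeFun (s : Set Omega1) (f : Omega1 → ZFSet.{0}) :
    IsFunctionSet (codeFun s f) := by
  refine ⟨fun p hp => ?_, fun x y z hy hz => ?_⟩
  · obtain ⟨γ, -, rfl⟩ := mem_codeFun.1 hp
    exact ⟨_, _, rfl⟩
  · obtain ⟨γ, -, hγ⟩ := mem_codeFun.1 hy
    obtain ⟨rfl, rfl⟩ := ZFSet.pair_inj.1 hγ
    exact (pair_mem_codeFun.1 hz).2

lemma restrictFun_codeFun (f : Omega1 → ZFSet.{0}) (β : Omega1) :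
    restrictFun (codeFun univ f) (codeOrd β) = codeFun (Iio β) f := by
  ext p
  rw [restrictFun, ZFSet.mem_sep, mem_codeFun, mem_codeFun]
  constructor
  · rintro ⟨⟨γ, -, rfl⟩, x, hx, y, hy⟩
    obtain ⟨rfl, -⟩ := ZFSet.pair_inj.1 hy
    exact ⟨γ, codeOrd_mem_codeOrd.1 hx, rfl⟩
  · rintro ⟨γ, hγ, rfl⟩
    exact ⟨⟨γ, mem_univ γ, rfl⟩, _, codeOrd_mem_codeOrd.2 hγ, _, rfl⟩

/-- Every uncountable disjoint family is guessed at some `β`: the club of the `β` at which there is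
an elementary submodel containing all the relevant objects meets the stationary set on which `B`
guesses the family. -/
theorem IsConstruction.exists_isGuessed {κ : Cardinal.{0}} {C : Omega1 → Set Omega1}
    {B : Omega1 → Set (Finset Omega1)} {U : Omega1 → Omega1 → Set Omega1}
    {φ : Omega1 → Omega1 → Finset ℝ} (hκ : 2 ^ (ℵ₁ : Cardinal.{0}) ≤ κ)
    (hB : IsFinsetDiamondSeq B) (h : IsConstruction κ C B U φ) {𝓑 : Set (Finset Omega1)}
    (h𝓑 : ¬ 𝓑.Countable) (h𝓑d : 𝓑.PairwiseDisjoint id) :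
    ∃ β, IsGuessed κ B U φ β ∧ B β ⊆ 𝓑 := by
  obtain ⟨θ, hθ⟩ : ∃ θ, κ < θ := ⟨_, Order.lt_succ κ⟩
  have hκ1 : ℵ₁ ≤ κ := (Cardinal.cantor _).le.trans hκ
  have hκ0 : ℵ₀ ≤ κ := (Cardinal.aleph0_le_aleph 1).trans hκ1
  have hκc : 𝔠 ≤ κ := by
    rw [← Cardinal.two_power_aleph0]
    exact (Cardinal.power_le_power_left two_ne_zero (Cardinal.aleph0_le_aleph 1)).trans hκ
  let V : Omega1 → ZFSet.{0} := fun γ => codeSet codeOrd (limitSet U γ)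
  have hV : ∀ γ, HCardLE κ (V γ) := fun γ => HCardLE.codeSet hκ0
    ((Cardinal.mk_set_le _).trans (mk_omega1.le.trans hκ1)) fun δ _ => HCardLE.codeOrd hκ1 δ
  have hofLE : ∀ {x : ZFSet.{0}}, HCardLE κ x → ∃ y : HSet θ, y.1 = x := fun hx =>
    ⟨HSet.ofLE hθ hx, rfl⟩
  choose o ho using fun γ => hofLE (HCardLE.codeOrd hκ1 γ)
  obtain ⟨r, hr⟩ := hofLE (HCardLE.codeRatStars hκc)
  obtain ⟨d, hd⟩ := hofLE (HCardLE.codeFun hκ1 (s := univ) fun γ => HCardLE.codeFamily hκ1 (B γ))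
  obtain ⟨g, hg⟩ := hofLE
    (HCardLE.codeFun hκ1 (s := univ) fun γ => HCardLE.codeRealFinset hκ0 (limitMap φ γ))
  obtain ⟨b, hb⟩ := hofLE (HCardLE.codeFamily hκ1 𝓑)
  obtain ⟨v, hv⟩ := hofLE (HCardLE.codeFun hκ1 (s := univ) hV)
  obtain ⟨E, hE, hES⟩ := exists_club_submodel (P := {r, d, g, b, v}) (by simp) ho
  obtain ⟨β, hβ𝓑, hβE⟩ := hB 𝓑 h𝓑 hE
  obtain ⟨S, hSc, hPS, hoS⟩ := hES β hβE
  have hS : IsSubmodelAt S β v := by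
    refine ⟨hPS (by simp), ⟨V, hv⟩, fun x γ hx => ?_⟩
    rw [← hoS γ, show x = o γ from Subtype.ext (hx.trans (ho γ).symm)]
  have hβ : 𝓑 ∩ finsetsBelow β = B β := hβ𝓑
  refine ⟨β, ⟨hβ.ge.trans inter_subset_right, h𝓑d.subset (hβ.ge.trans inter_subset_left), θ, hθ,
    Subtype.val '' (S : Set (HSet θ)), ?_⟩, hβ.ge.trans inter_subset_left⟩
  have hmem : ∀ {x : ZFSet.{0}} (y : HSet θ), y.1 = x → y ∈ S →
      x ∈ Subtype.val '' (S : Set (HSet θ)) := fun y hy hyS => ⟨y, hyS, hy⟩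
  refine
    { countable := hSc.image _
      elementary := ⟨S, rfl⟩
      inter_omega1 := ?_
      ratStars_mem := hmem r hr (hPS (by simp))
      diamond_mem := hmem d hd (hPS (by simp))
      exists_map := ⟨_, hmem g hg (hPS (by simp)), isFunctionSet_codeFun _ _, ?_⟩
      exists_family := ⟨_, hmem b hb (hPS (by simp)), fun hc => ?_, ?_⟩
      exists_sequence := ⟨V, hmem v hv (hPS (by simp)), fun γ hγ => ?_⟩ }
  · ext x
    constructor
    · rintro ⟨⟨y, hy, rfl⟩, γ, hγ⟩
      exact ⟨γ, (hS.ord_mem_iff y γ hγ.symm).1 hy, hγ⟩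
    · rintro ⟨γ, hγ, rfl⟩
      exact ⟨hmem (o γ) (ho γ) ((hoS γ).2 hγ), γ, rfl⟩
  · refine (restrictFun_codeFun _ β).trans ?_
    ext p
    rw [mem_codeFun, mem_codeFun]
    refine exists_congr fun γ => and_congr_right fun hγ => ?_
    rw [h.limitMap_eq (le_of_lt hγ)]
  · refine h𝓑 (countable_of_injective_of_countable_image codeFinset_injective.injOn
      (hc.mono ?_))
    rintro _ ⟨F, hF, rfl⟩
    exact codeFinset_mem_codeFamily.2 hF
  · rw [← hβ]
    ext x
    constructor
    · rintro ⟨⟨y, hy, rfl⟩, hyb⟩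
      obtain ⟨F, hF, hFy⟩ := mem_codeFamily.1 hyb
      refine ⟨F, ⟨hF, fun γ hγ => ?_⟩, hFy⟩
      -- a finite member of an elementary submodel is a subset of it
      rw [← hoS γ]
      refine hS.mem_of_mem_countable hκ1 hθ hy (hFy ▸ HCardLE.codeFinset hκ1 F) ?_
        (by rw [ho, ← hFy]; exact codeOrd_mem_codeFinset.2 hγ)
      refine (F.countable_toSet.image codeOrd).mono fun z hz => ?_
      obtain ⟨δ, hδ, rfl⟩ := mem_codeFinset.1 (hFy.symm ▸ hz : z ∈ codeFinset F)
      exact ⟨δ, hδ, rfl⟩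
    · rintro ⟨F, ⟨hF, hFβ⟩, rfl⟩
      obtain ⟨y, hy, hyF⟩ := hS.codeFinset_mem (hκ1.trans_lt hθ) F hFβ
      exact ⟨⟨y, hy, hyF⟩, codeFinset_mem_codeFamily.2 hF⟩
  · ext x
    rw [ZFSet.mem_inter, mem_codeSet, mem_codeSet, mem_codeOrd]
    constructor
    · rintro ⟨⟨δ, hδ, rfl⟩, δ', hδ', he⟩
      obtain rfl := codeOrd_injective he
      exact ⟨δ', ⟨(h.mem_limitSet_iff hγ.le hδ'.le).1 hδ, hδ'⟩, rfl⟩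
    · rintro ⟨δ, ⟨hδ, hδβ⟩, rfl⟩
      exact ⟨⟨δ, (h.mem_limitSet_iff hγ.le (le_of_lt hδβ)).2 hδ, rfl⟩, δ, hδβ, rfl⟩

theorem mainTheorem1 (hD : Diamond) (κ : Cardinal.{0}) (hκ : 2 ^ (ℵ₁ : Cardinal.{0}) ≤ κ) :
    (∃ C : Omega1 → Set Omega1, EnumeratesCountableSets C) ∧
    (∃ B : Omega1 → Set (Finset Omega1), IsFinsetDiamondSeq B) ∧
    ∀ (C : Omega1 → Set Omega1) (B : Omega1 → Set (Finset Omega1)),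
      EnumeratesCountableSets C → IsFinsetDiamondSeq B →
      (∃ (U : Omega1 → Omega1 → Set Omega1) (φ : Omega1 → Omega1 → Finset ℝ),
        IsConstruction κ C B U φ) ∧
      ∀ (U : Omega1 → Omega1 → Set Omega1) (φ : Omega1 → Omega1 → Finset ℝ),
        IsConstruction κ C B U φ →
          @HereditarilyLindelofSpace Omega1 (limitTopology U φ) ∧
          @T2Space Omega1 (limitTopology U φ) ∧
          HasCountablePsiWeight (limitTopology U φ) ∧
          ¬ IsDSpace (limitTopology U φ) := by
  refine ⟨hD.exists_enumeration, hD.exists_finsetDiamondSeq, fun C B hC hB => ⟨?_, fun U φ h => ?_⟩⟩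
  · obtain ⟨D, hDgood⟩ := exists_forall_goodAt hκ hC.2 hB
    exact ⟨D.levelSet, D.levelMap, ConstructionData.isConstruction hC.2 hDgood⟩
  · have hL := h.hereditarilyLindelofSpace fun 𝓑 h𝓑 h𝓑d => h.exists_isGuessed hκ hB h𝓑 h𝓑d
    exact ⟨hL, h.t2Space, h.hasCountablePsiWeight, h.not_isDSpace hC hL⟩
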